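/- Theorem 1.1 ("Log-concave Bernstein theorem"). Let $\varphi:[0,\infty)\to\mathbb R$ be continuous on $[0,\infty)$ and $C^\infty$-smooth on $(0,\infty)$. For $t>0$ and integers $n\ge 0$ put $$a_t(n)=(-1)^n\,\frac{\varphi^{(n)}(t)}{n!}.$$ Then the following are equivalent. (i) For every $t>0$ the sequence $(a_t(n))_{n\ge 0}$ is log-concave, that is, $a_t(n)\ge 0$ for all $n\ge 0$, and for all integers $m,n\ge 0$ and all $\lambda\in(0,1)$ such that $\lambda n+(1-\lambda)m$ is an integer, $$a_t(\lambda n+(1-\lambda)m)\ \ge\ a_t(n)^{\lambda}\,a_t(m)^{1-\lambda}.$$ (ii) There is a finite log-concave Borel measure $\mu$ on $[0,\infty)$ such that $$\varphi(t)=\int_{[0,\infty)}e^{-tx}\,d\mu(x)\qquad\text{for all } t\ge 0.$$ Here a measure $\mu$ on $[0,\infty)$ is called log-concave if either $\mu=c\,\delta_{x_0}$ for some real $c\ge 0$ and some $x_0\ge 0$, or $\mu$ is absolutely continuous with respect to Lebesgue measure on $[0,\infty)$ with a density $f:[0,\infty)\to\mathbb R$ that is log-concave, that is, $f\ge 0$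 and $$f(\lambda x+(1-\lambda)y)\ \ge\ f(x)^{\lambda}f(y)^{1-\lambda}\qquad\text{for all } x,y\ge 0,\ 0<\lambda<1.$$ -/

import Mathlib

open MeasureTheory Set
open scoped ContDiff NNReal

/-- A sequence of real numbers is log-concave if its terms are non-negative and
`a (l * n + (1 - l) * m) ≥ a n ^ l * a m ^ (1 - l)` for all indices `m`, `n` and all `l ∈ (0, 1)`
for which `l * n + (1 - l) * m` is an integer `k` (necessarily `k ≥ 0`). -/
def IsLogConcaveSeq (a : ℕ → ℝ) : Prop :=
  (∀ n, 0 ≤ a n) ∧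
    ∀ (m n k : ℕ) (l : ℝ), 0 < l → l < 1 → l * (n : ℝ) + (1 - l) * (m : ℝ) = (k : ℝ) →
      a n ^ l * a m ^ (1 - l) ≤ a k

/-- A real function is log-concave on a convex set `K` of a real vector space if it is
non-negative on `K` and `f (l x + (1 - l) y) ≥ f x ^ l * f y ^ (1 - l)` for all `x, y ∈ K` and
`0 < l < 1`. -/
def IsLogConcaveOn {E : Type*} [AddCommGroup E] [Module ℝ E] (K : Set E) (f : E → ℝ) : Prop :=
  Convex ℝ K ∧ (∀ x ∈ K, 0 ≤ f x) ∧
    ∀ x ∈ K, ∀ y ∈ K, ∀ l : ℝ, 0 < l → l < 1 →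
      f x ^ l * f y ^ (1 - l) ≤ f (l • x + (1 - l) • y)

/-- The alternating Taylor coefficients `(-1)^n φ^{(n)}(t) / n!`; for `t > 0` they only depend on
the values of `φ` near `t`. -/
noncomputable def altTaylorCoeff (φ : ℝ → ℝ) (t : ℝ) (n : ℕ) : ℝ :=
  (-1) ^ n * iteratedDeriv n φ t / (n.factorial : ℝ)

/-- A log-concave measure on the half-line `[0, ∞)`, seen as a Borel measure on `ℝ` that is
concentrated on `[0, ∞)`: either a non-negative multiple of a Dirac mass at a point of `[0, ∞)`,
or a measure which has, with respect to Lebesgue measure on `[0, ∞)`, a density that is a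
log-concave function on `[0, ∞)`. Such a density is automatically measurable on `[0, ∞)`. -/
def IsLogConcaveMeasureOnHalfLine (μ : Measure ℝ) : Prop :=
  (∃ (c : ℝ≥0) (x₀ : ℝ), 0 ≤ x₀ ∧ μ = c • Measure.dirac x₀) ∨
    ∃ f : ℝ → ℝ, IsLogConcaveOn (Ici (0 : ℝ)) f ∧
      μ = (volume.restrict (Ici (0 : ℝ))).withDensity (fun x => ENNReal.ofReal (f x))

/-!
For `t > 0` let the measure `taylorMeasure φ t` carry mass `t ^ n * a_t(n)` at `n / t`. By Taylor
expansion at `t` its Laplace transform at `u` is `φ (t * (1 - exp (-u / t)))`, which tends to `φ u`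
as `t → ∞`. If the sequences `a_t` are log-concave, these measures are log-concave on balls up to
an error of order `1 / t`. Continuity of `φ` at `0` makes them tight, and a weak limit `μ` has
Laplace transform `φ` and is log-concave on balls without error. Hence the lower density of `μ` is
a log-concave function: either it is finite and `μ` is absolutely continuous, or it is infinite at
one point and `μ` is a multiple of a Dirac measure.

Conversely, if `φ` is the Laplace transform of a measure with log-concave density `f`, then `a_t(n)`
is the `n`-th moment of `f x * exp (-t x)` divided by `n !`. For an exponential density these
normalized moments form a geometric sequence, and log-concavity follows by comparing
`f x * exp (-t x)` with the exponential that has the same moments of orders `n` and `n + 2`.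
-/

open Filter Topology
open scoped ENNReal

/-! ### Pólya frequency sequences -/

/-- A nonnegative sequence indexed by `ℤ` is a Pólya frequency sequence (of order two) if
`w (p - 1) * w (q + 1) ≤ w p * w q` for `p ≤ q`: it is log-concave and its support has no gaps.
Bi-infinite sequences avoid boundary cases when windows slide over the origin. -/
structure IsPolyaFreqSeq (w : ℤ → ℝ) : Prop where
  nonneg : ∀ n, 0 ≤ w n
  mul_le : ∀ p q, p ≤ q → w (p - 1) * w (q + 1) ≤ w p * w q

theorem sum_range_int_add_eq_sum_Ico {M : Type*} [AddCommMonoid M] (f : ℤ → M) (p : ℤ) (N : ℕ) :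
    ∑ i ∈ Finset.range N, f (p + i) = ∑ n ∈ Finset.Ico p (p + N), f n := by
  simp [Int.Ico_eq_finset_map]

namespace IsPolyaFreqSeq

variable {w : ℤ → ℝ}

theorem mul_le_mul_of_add_nat_le (hw : IsPolyaFreqSeq w) {a d : ℤ} (j : ℕ) (h : a + j ≤ d - j) :
    w a * w d ≤ w (a + j) * w (d - j) := by
  induction j with
  | zero => simp
  | succ j ih =>
    push_cast at h ⊢
    calc w a * w d ≤ w (a + j) * w (d - j) := ih (by lia)
      _ = w (a + (j + 1) - 1) * w (d - (j + 1) + 1) := by ring_nf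
      _ ≤ w (a + (j + 1)) * w (d - (j + 1)) := hw.mul_le _ _ h

theorem mul_le_mul_of_add_eq_add (hw : IsPolyaFreqSeq w) {a b c d : ℤ} (hab : a ≤ b) (hac : a ≤ c)
    (h : a + d = b + c) : w a * w d ≤ w b * w c := by
  wlog hbc : b ≤ c generalizing b c
  · rw [mul_comm (w b)]
    exact this hac hab (by lia) (by lia)
  obtain ⟨j, rfl⟩ := Int.le.dest hab
  obtain rfl : c = d - j := by lia
  exact hw.mul_le_mul_of_add_nat_le j hbc

theorem sum_Ico (hw : IsPolyaFreqSeq w) (N : ℕ) :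
    IsPolyaFreqSeq fun p => ∑ n ∈ Finset.Ico p (p + N), w n where
  nonneg p := Finset.sum_nonneg fun n _ => hw.nonneg n
  mul_le p q hpq := by
    simp only [← sum_range_int_add_eq_sum_Ico]
    have shift (r : ℤ) : (∑ i ∈ Finset.range N, w (r + i)) + w (r + N)
        = w r + ∑ i ∈ Finset.range N, w (r + 1 + i) := by
      rw [← Finset.sum_range_succ (fun i : ℕ => w (r + i)),
        Finset.sum_range_succ' (fun i : ℕ => w (r + i)), add_comm]
      simp only [Nat.cast_zero, add_zero, Nat.cast_add, Nat.cast_one, add_assoc,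
        add_comm (1 : ℤ)]
    have shift_left := shift (p - 1)
    have shift_right := shift q
    rw [sub_add_cancel] at shift_left
    have h_first : w (p - 1) * ∑ i ∈ Finset.range N, w (q + 1 + i)
        ≤ (∑ i ∈ Finset.range N, w (p + i)) * w q := by
      rw [Finset.mul_sum, Finset.sum_mul]
      exact Finset.sum_le_sum fun i _ =>
        hw.mul_le_mul_of_add_eq_add (by lia) (by lia) (by ring)
    have h_last : (∑ i ∈ Finset.range N, w (p + i)) * w (q + N)
        ≤ w (p - 1 + N) * ∑ i ∈ Finset.range N, w (q + 1 + i) := by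
      rw [Finset.mul_sum, Finset.sum_mul]
      refine Finset.sum_le_sum fun i hi => ?_
      have := Finset.mem_range.1 hi
      exact hw.mul_le_mul_of_add_eq_add (by lia) (by lia) (by ring)
    rw [eq_sub_of_add_eq shift_left, eq_sub_of_add_eq shift_right]
    linarith

theorem le_mul_pow (hw : IsPolyaFreqSeq w) {k : ℤ} (hk : 0 < w k) (i : ℕ) :
    w (k + i) ≤ w k * (w (k + 1) / w k) ^ i := by
  have hr : 0 ≤ w (k + 1) / w k := div_nonneg (hw.nonneg _) hk.le
  induction i with
  | zero => simp
  | succ i ih =>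
    have h := hw.mul_le_mul_of_add_eq_add (a := k) (d := k + (i + 1)) (b := k + i) (c := k + 1)
      (by lia) (by lia) (by ring)
    push_cast
    calc w (k + (i + 1)) = w k * w (k + (i + 1)) / w k := by field_simp
      _ ≤ w (k + i) * w (k + 1) / w k := by gcongr
      _ = w (k + i) * (w (k + 1) / w k) := by ring
      _ ≤ w k * (w (k + 1) / w k) ^ i * (w (k + 1) / w k) := by gcongr
      _ = _ := by ring

theorem mul_pow_le (hw : IsPolyaFreqSeq w) {k : ℤ} (hk : 0 < w k) (i : ℕ) :
    w (k - i) * (w (k + 1) / w k) ^ i ≤ w k := by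
  have hr : 0 ≤ w (k + 1) / w k := div_nonneg (hw.nonneg _) hk.le
  induction i with
  | zero => simp
  | succ i ih =>
    have h := hw.mul_le_mul_of_add_eq_add (a := k - (i + 1)) (d := k + 1) (b := k - i) (c := k)
      (by lia) (by lia) (by ring)
    push_cast
    calc w (k - (i + 1)) * (w (k + 1) / w k) ^ (i + 1)
        = w (k - (i + 1)) * w (k + 1) / w k * (w (k + 1) / w k) ^ i := by ring
      _ ≤ w (k - i) * w k / w k * (w (k + 1) / w k) ^ i := by gcongr
      _ = w (k - i) * (w (k + 1) / w k) ^ i := by field_simp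
      _ ≤ w k := ih

theorem le_mul_zpow (hw : IsPolyaFreqSeq w) {k : ℤ} (hk : 0 < w k) (hk' : 0 < w (k + 1)) (j : ℤ) :
    w j ≤ w k * (w (k + 1) / w k) ^ (j - k) := by
  rcases le_total k j with hj | hj
  · obtain ⟨i, rfl⟩ := Int.le.dest hj
    rw [add_sub_cancel_left, zpow_natCast]
    exact hw.le_mul_pow hk i
  · obtain ⟨i, rfl⟩ := Int.le.dest hj
    have h := hw.mul_pow_le hk i
    rw [add_sub_cancel_right] at h
    rwa [sub_add_cancel_left, zpow_neg, zpow_natCast, ← div_eq_mul_inv,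
      le_div_iff₀ (pow_pos (div_pos hk' hk) i)]

theorem rpow_mul_rpow_le (hw : IsPolyaFreqSeq w) {k : ℤ} (hk : 0 < w k) (hk' : 0 < w (k + 1))
    (m n : ℤ) {l : ℝ} (hl : 0 ≤ l) (hl' : l ≤ 1) :
    w m ^ l * w n ^ (1 - l) ≤ w k * (w (k + 1) / w k) ^ (l * m + (1 - l) * n - k) := by
  set r := w (k + 1) / w k
  have hr : 0 < r := div_pos hk' hk
  have hm := hw.le_mul_zpow hk hk' m
  have hn := hw.le_mul_zpow hk hk' n
  have : 0 ≤ 1 - l := by linarith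
  have := hw.nonneg m
  have := hw.nonneg n
  calc w m ^ l * w n ^ (1 - l)
      ≤ (w k * r ^ (m - k)) ^ l * (w k * r ^ (n - k)) ^ (1 - l) := by gcongr
    _ = (w k ^ l * w k ^ (1 - l)) * (r ^ (((m - k : ℤ) : ℝ) * l) *
          r ^ (((n - k : ℤ) : ℝ) * (1 - l))) := by
        rw [Real.mul_rpow hk.le (by positivity), Real.mul_rpow hk.le (by positivity),
          Real.rpow_mul hr.le, Real.rpow_mul hr.le, Real.rpow_intCast, Real.rpow_intCast]
        ring
    _ = _ := by
        rw [← Real.rpow_add hk, ← Real.rpow_add hr, add_sub_cancel, Real.rpow_one]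
        congr 2
        push_cast
        ring

theorem pos_of_le_of_le (hw : IsPolyaFreqSeq w) {m n k : ℤ} (hm : 0 < w m) (hn : 0 < w n)
    (hmk : m ≤ k) (hkn : k ≤ n) : 0 < w k := by
  have h := hw.mul_le_mul_of_add_eq_add (a := m) (d := n) (b := k) (c := m + n - k)
    hmk (by lia) (by ring)
  exact pos_of_mul_pos_left ((mul_pos hm hn).trans_le h) (hw.nonneg _)

theorem rpow_mul_rpow_le_floor (hw : IsPolyaFreqSeq w) (m n : ℤ) {l : ℝ} (hl : 0 < l)
    (hl' : l < 1) :
    w m ^ l * w n ^ (1 - l) ≤ w ⌊l * m + (1 - l) * n⌋ ^ (1 - Int.fract (l * m + (1 - l) * n)) *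
      w (⌊l * m + (1 - l) * n⌋ + 1) ^ Int.fract (l * m + (1 - l) * n) := by
  wlog hmn : m ≤ n generalizing m n l
  · have := this n m (l := 1 - l) (by linarith) (by linarith) (le_of_not_ge hmn)
    rwa [sub_sub_cancel, mul_comm (w n ^ _), add_comm ((1 - l) * _)] at this
  set κ : ℝ := l * m + (1 - l) * n with hκ
  have h1l : 0 < 1 - l := by linarith
  have rhs_nonneg : 0 ≤ w ⌊κ⌋ ^ (1 - Int.fract κ) * w (⌊κ⌋ + 1) ^ Int.fract κ :=
    mul_nonneg (Real.rpow_nonneg (hw.nonneg _) _) (Real.rpow_nonneg (hw.nonneg _) _)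
  rcases (hw.nonneg m).eq_or_lt' with hm | hm
  · rwa [hm, Real.zero_rpow hl.ne', zero_mul]
  rcases (hw.nonneg n).eq_or_lt' with hn | hn
  · rwa [hn, Real.zero_rpow h1l.ne', mul_zero]
  rcases hmn.eq_or_lt with rfl | hmn
  · have : κ = m := by rw [hκ]; ring
    rw [this, Int.floor_intCast, Int.fract_intCast, sub_zero, Real.rpow_one, Real.rpow_zero,
      mul_one, ← Real.rpow_add hm, add_sub_cancel, Real.rpow_one]
  have hmn' : (m : ℝ) < n := Int.cast_lt.2 hmn
  have hm_le : m ≤ ⌊κ⌋ := Int.le_floor.2 (by rw [hκ]; nlinarith)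
  have hlt_n : ⌊κ⌋ < n := Int.floor_lt.2 (by rw [hκ]; nlinarith)
  have hk : 0 < w ⌊κ⌋ := hw.pos_of_le_of_le hm hn hm_le hlt_n.le
  have hk' : 0 < w (⌊κ⌋ + 1) := hw.pos_of_le_of_le hm hn (by lia) hlt_n
  calc w m ^ l * w n ^ (1 - l) ≤ w ⌊κ⌋ * (w (⌊κ⌋ + 1) / w ⌊κ⌋) ^ Int.fract κ :=
        hw.rpow_mul_rpow_le hk hk' m n hl.le hl'.le
    _ = w ⌊κ⌋ ^ (1 - Int.fract κ) * w (⌊κ⌋ + 1) ^ Int.fract κ := by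
        rw [Real.div_rpow hk'.le hk.le, Real.rpow_sub hk, Real.rpow_one]
        ring

theorem rpow_mul_rpow_le_of_eq (hw : IsPolyaFreqSeq w) {m n k : ℤ} {l : ℝ} (hl : 0 < l)
    (hl' : l < 1) (hk : l * m + (1 - l) * n = k) : w m ^ l * w n ^ (1 - l) ≤ w k := by
  simpa only [hk, Int.floor_intCast, Int.fract_intCast, sub_zero, Real.rpow_one, Real.rpow_zero,
    mul_one] using hw.rpow_mul_rpow_le_floor m n hl hl'

theorem exists_rpow_mul_rpow_le (hw : IsPolyaFreqSeq w) (m n : ℤ) {l : ℝ} (hl : 0 < l)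
    (hl' : l < 1) : ∃ k : ℤ, |k - (l * m + (1 - l) * n)| ≤ 1 ∧ w m ^ l * w n ^ (1 - l) ≤ w k := by
  set κ : ℝ := l * m + (1 - l) * n
  have h := hw.rpow_mul_rpow_le_floor m n hl hl'
  have hfloor := Int.floor_le κ
  have hlt := Int.lt_floor_add_one κ
  have mean_le : w ⌊κ⌋ ^ (1 - Int.fract κ) * w (⌊κ⌋ + 1) ^ Int.fract κ
      ≤ max (w ⌊κ⌋) (w (⌊κ⌋ + 1)) :=
    (Real.geom_mean_le_arith_mean2_weighted (sub_nonneg.2 (Int.fract_lt_one κ).le)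
      (Int.fract_nonneg κ) (hw.nonneg _) (hw.nonneg _) (sub_add_cancel _ _)).trans
      (Convex.combo_le_max _ _
        (sub_nonneg.2 (Int.fract_lt_one κ).le) (Int.fract_nonneg κ) (sub_add_cancel _ _))
  rcases le_max_iff.1 (h.trans mean_le) with hk | hk
  · exact ⟨⌊κ⌋, abs_le.2 ⟨by linarith, by linarith⟩, hk⟩
  · exact ⟨⌊κ⌋ + 1, abs_le.2 ⟨by push_cast; linarith, by push_cast; linarith⟩, hk⟩

end IsPolyaFreqSeq

/-- The extension by zero of a sequence to negative indices. -/
def extendInt (a : ℕ → ℝ) (n : ℤ) : ℝ := if 0 ≤ n then a n.toNat else 0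

@[simp]
theorem extendInt_natCast (a : ℕ → ℝ) (n : ℕ) : extendInt a n = a n := by simp [extendInt]

theorem extendInt_of_neg (a : ℕ → ℝ) {n : ℤ} (hn : n < 0) : extendInt a n = 0 := by
  simp [extendInt, hn]

theorem extendInt_nonneg {a : ℕ → ℝ} (ha : ∀ n, 0 ≤ a n) (n : ℤ) : 0 ≤ extendInt a n := by
  unfold extendInt
  split_ifs
  exacts [ha _, le_rfl]

theorem isPolyaFreqSeq_extendInt {a : ℕ → ℝ} (ha : ∀ n, 0 ≤ a n)
    (h : ∀ p q, p ≤ q → a p * a (q + 2) ≤ a (p + 1) * a (q + 1)) :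
    IsPolyaFreqSeq (extendInt a) where
  nonneg := extendInt_nonneg ha
  mul_le p q hpq := by
    rcases lt_or_ge (p - 1) 0 with hp | hp
    · rw [extendInt_of_neg a hp, zero_mul]
      exact mul_nonneg (extendInt_nonneg ha _) (extendInt_nonneg ha _)
    obtain ⟨i, hi⟩ := Int.eq_ofNat_of_zero_le hp
    obtain ⟨j, hj⟩ := Int.eq_ofNat_of_zero_le (show 0 ≤ q - 1 by lia)
    obtain rfl : p = (i + 1 : ℕ) := by push_cast; lia
    obtain rfl : q = (j + 1 : ℕ) := by push_cast; lia
    rw [hi, show ((j + 1 : ℕ) : ℤ) + 1 = (j + 2 : ℕ) by push_cast; ring]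
    simp only [extendInt_natCast]
    exact h i j (by lia)

namespace IsLogConcaveSeq

variable {a : ℕ → ℝ}

-- Both inner indices are convex combinations of `p` and `q + 2`, with complementary weights.
theorem mul_le (ha : IsLogConcaveSeq a) {p q : ℕ} (hpq : p ≤ q) :
    a p * a (q + 2) ≤ a (p + 1) * a (q + 1) := by
  have hpq' : (p : ℝ) ≤ q := Nat.cast_le.2 hpq
  have hd : (0 : ℝ) < q + 2 - p := by linarith
  set l : ℝ := 1 / (q + 2 - p) with hl
  have hl0 : 0 < l := by positivity
  have hl1 : l < 1 := by
    rw [hl, div_lt_one hd]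
    linarith
  have hmul : l * (q + 2 - p) = 1 := by rw [hl]; field_simp
  have h_left := ha.2 p (q + 2) (p + 1) l hl0 hl1 (by push_cast; linarith)
  have h_right := ha.2 (q + 2) p (q + 1) l hl0 hl1 (by push_cast; linarith)
  have split (n : ℕ) : a n ^ l * a n ^ (1 - l) = a n := by
    rw [← Real.rpow_add' (ha.1 n) (by simp), add_sub_cancel, Real.rpow_one]
  calc a p * a (q + 2)
      = (a p ^ l * a p ^ (1 - l)) * (a (q + 2) ^ l * a (q + 2) ^ (1 - l)) := by
        rw [split, split]
    _ = (a (q + 2) ^ l * a p ^ (1 - l)) * (a p ^ l * a (q + 2) ^ (1 - l)) := by ring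
    _ ≤ a (p + 1) * a (q + 1) := by
        have := ha.1
        gcongr <;> apply_rules [mul_nonneg, Real.rpow_nonneg]

theorem isPolyaFreqSeq_extendInt (ha : IsLogConcaveSeq a) : IsPolyaFreqSeq (extendInt a) :=
  _root_.isPolyaFreqSeq_extendInt ha.1 fun _ _ => ha.mul_le

end IsLogConcaveSeq

theorem isLogConcaveSeq_iff {a : ℕ → ℝ} :
    IsLogConcaveSeq a ↔
      (∀ n, 0 ≤ a n) ∧ ∀ p q, p ≤ q → a p * a (q + 2) ≤ a (p + 1) * a (q + 1) := by
  refine ⟨fun ha => ⟨ha.1, fun _ _ => ha.mul_le⟩, fun h => ⟨h.1, fun m n k l hl hl' hk => ?_⟩⟩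
  simpa using (isPolyaFreqSeq_extendInt h.1 h.2).rpow_mul_rpow_le_of_eq (m := n) (n := m) (k := k)
    hl hl' (by simpa using hk)

theorem isLogConcaveSeq_of_pos {a : ℕ → ℝ} (hpos : ∀ n, 0 < a n)
    (h : ∀ n, a n * a (n + 2) ≤ a (n + 1) ^ 2) : IsLogConcaveSeq a := by
  have ratio_antitone : Antitone fun n => a (n + 1) / a n := antitone_nat_of_succ_le fun n => by
    rw [div_le_div_iff₀ (hpos _) (hpos _)]
    linarith [h n]
  refine isLogConcaveSeq_iff.2 ⟨fun n => (hpos n).le, fun p q hpq => ?_⟩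
  have := ratio_antitone (hpq.trans q.le_succ)
  rw [div_le_div_iff₀ (hpos _) (hpos _)] at this
  linarith

theorem IsLogConcaveSeq.pow_mul {a : ℕ → ℝ} (ha : IsLogConcaveSeq a) {r : ℝ} (hr : 0 ≤ r) :
    IsLogConcaveSeq fun n => r ^ n * a n := by
  refine isLogConcaveSeq_iff.2 ⟨fun n => mul_nonneg (pow_nonneg hr n) (ha.1 n), fun p q hpq => ?_⟩
  calc r ^ p * a p * (r ^ (q + 2) * a (q + 2)) = r ^ (p + q + 2) * (a p * a (q + 2)) := by ring
    _ ≤ r ^ (p + q + 2) * (a (p + 1) * a (q + 1)) := by have := ha.mul_le hpq; gcongr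
    _ = r ^ (p + 1) * a (p + 1) * (r ^ (q + 1) * a (q + 1)) := by ring

theorem isLogConcaveSeq_inv_factorial : IsLogConcaveSeq fun n => (n.factorial : ℝ)⁻¹ := by
  refine isLogConcaveSeq_of_pos (fun n => by positivity) fun n => ?_
  have : ((n + 2).factorial : ℝ) = (n + 2) * ((n + 1) * n.factorial) := by
    push_cast [Nat.factorial_succ]
    ring
  rw [this, Nat.factorial_succ, Nat.cast_mul, Nat.cast_succ, ← mul_inv, inv_pow]
  gcongr
  nlinarith [show (0 : ℝ) < n.factorial from by positivity]

theorem IsLogConcaveSeq.const_mul {a : ℕ → ℝ} (ha : IsLogConcaveSeq a) {c : ℝ} (hc : 0 ≤ c) :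
    IsLogConcaveSeq fun n => c * a n := by
  refine isLogConcaveSeq_iff.2 ⟨fun n => mul_nonneg hc (ha.1 n), fun p q hpq => ?_⟩
  calc c * a p * (c * a (q + 2)) = c ^ 2 * (a p * a (q + 2)) := by ring
    _ ≤ c ^ 2 * (a (p + 1) * a (q + 1)) := by have := ha.mul_le hpq; gcongr
    _ = c * a (p + 1) * (c * a (q + 1)) := by ring

/-! ### Completely monotone functions -/

theorem altTaylorCoeff_zero (φ : ℝ → ℝ) (t : ℝ) : altTaylorCoeff φ t 0 = φ t := by
  simp [altTaylorCoeff]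

theorem altTaylorCoeff_mul_sub_pow (φ : ℝ → ℝ) (s t : ℝ) (n : ℕ) :
    altTaylorCoeff φ t n * (t - s) ^ n = iteratedDeriv n φ t * (s - t) ^ n / n.factorial := by
  have sign : (-1) ^ n * (t - s) ^ n = (s - t) ^ n := by
    rw [← mul_pow, neg_one_mul, neg_sub]
  rw [altTaylorCoeff, ← sign]
  ring

theorem exists_sub_sum_altTaylorCoeff_eq {φ : ℝ → ℝ} {s t : ℝ} (hst : s < t) (n : ℕ)
    (hφ : ∀ x ∈ Icc s t, ContDiffAt ℝ (n + 1 : ℕ) φ x) :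
    ∃ ξ ∈ Ioo s t, φ s - ∑ k ∈ Finset.range (n + 1), altTaylorCoeff φ t k * (t - s) ^ k =
      (n + 1) * altTaylorCoeff φ ξ (n + 1) * (ξ - s) ^ n * (t - s) := by
  rw [← uIcc_of_ge hst.le] at hφ
  have hu : UniqueDiffOn ℝ (uIcc t s) := uniqueDiffOn_uIcc hst.ne'
  have deriv_eq : ∀ x ∈ uIcc t s, ∀ k ≤ n + 1,
      iteratedDerivWithin k φ (uIcc t s) x = iteratedDeriv k φ x := fun x hx k hk =>
    iteratedDerivWithin_eq_iteratedDeriv hu ((hφ x hx).of_le (by exact_mod_cast hk)) hx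
  have hcd : ContDiffOn ℝ (n + 1 : ℕ) φ (uIcc t s) := fun x hx => (hφ x hx).contDiffWithinAt
  obtain ⟨ξ, hξ, h⟩ := taylor_mean_remainder_cauchy (f := φ) (x := s) (x₀ := t) (n := n) hst.ne'
    (hcd.of_le (by exact_mod_cast n.le_succ)) ((hcd.differentiableOn_iteratedDerivWithin
      (by exact_mod_cast n.lt_succ_self) hu).mono uIoo_subset_uIcc_self)
  rw [taylor_within_apply, deriv_eq ξ (uIoo_subset_uIcc_self hξ) _ le_rfl] at h
  rw [uIoo_of_ge hst.le] at hξ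
  refine ⟨ξ, hξ, ?_⟩
  have taylor_eq : ∀ k ∈ Finset.range (n + 1), altTaylorCoeff φ t k * (t - s) ^ k =
      ((k.factorial : ℝ)⁻¹ * (s - t) ^ k) • iteratedDerivWithin k φ (uIcc t s) t := by
    intro k hk
    rw [deriv_eq t left_mem_uIcc k (Finset.mem_range.1 hk).le, altTaylorCoeff_mul_sub_pow,
      smul_eq_mul]
    ring
  have remainder_eq := altTaylorCoeff_mul_sub_pow φ s ξ (n + 1)
  have hξs : ξ - s ≠ 0 := (sub_pos.2 hξ.1).ne'
  have hfac : (n.factorial : ℝ) ≠ 0 := by positivity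
  rw [Finset.sum_congr rfl taylor_eq, h]
  rw [pow_succ, ← mul_assoc, ← eq_div_iff hξs] at remainder_eq
  rw [mul_assoc (_ + _), remainder_eq, Nat.factorial_succ]
  push_cast
  field_simp
  ring

/-- Complete monotonicity of a function on `(0, ∞)`: it is smooth and its derivatives alternate in
sign. The sign condition is expressed through the alternating Taylor coefficients. -/
structure IsCompletelyMonotone (φ : ℝ → ℝ) : Prop where
  contDiffOn : ContDiffOn ℝ ∞ φ (Ioi 0)
  altTaylorCoeff_nonneg : ∀ t, 0 < t → ∀ n, 0 ≤ altTaylorCoeff φ t n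

namespace IsCompletelyMonotone

variable {φ : ℝ → ℝ} {s t : ℝ}

theorem exists_remainder_eq (hφ : IsCompletelyMonotone φ) (hs : 0 < s) (hst : s < t) (n : ℕ) :
    ∃ ξ ∈ Ioo s t, φ s - ∑ k ∈ Finset.range (n + 1), altTaylorCoeff φ t k * (t - s) ^ k =
      (n + 1) * altTaylorCoeff φ ξ (n + 1) * (ξ - s) ^ n * (t - s) :=
  exists_sub_sum_altTaylorCoeff_eq hst n fun x hx =>
    (hφ.contDiffOn.of_le (by exact_mod_cast le_top)).contDiffAt (Ioi_mem_nhds (hs.trans_le hx.1))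

theorem term_nonneg (hφ : IsCompletelyMonotone φ) (ht : 0 < t) (hst : s ≤ t) (n : ℕ) :
    0 ≤ altTaylorCoeff φ t n * (t - s) ^ n :=
  mul_nonneg (hφ.altTaylorCoeff_nonneg t ht n) (pow_nonneg (sub_nonneg.2 hst) n)

theorem sum_le (hφ : IsCompletelyMonotone φ) (hs : 0 < s) (hst : s < t) (n : ℕ) :
    ∑ k ∈ Finset.range n, altTaylorCoeff φ t k * (t - s) ^ k ≤ φ s := by
  obtain ⟨ξ, hξ, h⟩ := hφ.exists_remainder_eq hs hst n
  have hcoeff := hφ.altTaylorCoeff_nonneg ξ (hs.trans hξ.1) (n + 1)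
  have hξs : 0 ≤ ξ - s := sub_nonneg.2 hξ.1.le
  have : 0 ≤ t - s := sub_nonneg.2 hst.le
  have remainder_nonneg : 0 ≤ (n + 1) * altTaylorCoeff φ ξ (n + 1) * (ξ - s) ^ n * (t - s) := by
    positivity
  rw [Finset.sum_range_succ] at h
  linarith [hφ.term_nonneg (hs.trans hst) hst.le n]

theorem term_le (hφ : IsCompletelyMonotone φ) (hs : 0 < s) (hst : s < t) (n : ℕ) :
    altTaylorCoeff φ t n * (t - s) ^ n ≤ φ s :=
  (Finset.single_le_sum (f := fun k => altTaylorCoeff φ t k * (t - s) ^ k)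
    (fun k _ => hφ.term_nonneg (hs.trans hst) hst.le k) (Finset.self_mem_range_succ n)).trans
    (hφ.sum_le hs hst (n + 1))

-- The coefficient in the Cauchy remainder is controlled by the expansion of `φ s'` for `s' < s`.
theorem remainder_le (hφ : IsCompletelyMonotone φ) {s' : ℝ} (hs' : 0 < s') (hs's : s' < s)
    (hst : s < t) (n : ℕ) :
    φ s - ∑ k ∈ Finset.range (n + 1), altTaylorCoeff φ t k * (t - s) ^ k ≤
      φ s' * (t - s) / (s - s') * ((n + 1) * ((t - s) / (t - s')) ^ n) := by
  have hs := hs'.trans hs's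
  obtain ⟨ξ, hξ, h⟩ := hφ.exists_remainder_eq hs hst n
  set q := (t - s) / (t - s') with hq
  have : 0 ≤ t - s := sub_nonneg.2 hst.le
  have hts' : 0 < t - s' := sub_pos.2 (hs's.trans hst)
  have hξs : 0 ≤ ξ - s := sub_nonneg.2 hξ.1.le
  have hss' : 0 < s - s' := sub_pos.2 hs's
  have hcoeff := hφ.altTaylorCoeff_nonneg ξ (hs.trans hξ.1) (n + 1)
  have ratio_le : ξ - s ≤ q * (ξ - s') := by
    rw [hq, div_mul_eq_mul_div, le_div_iff₀ hts']
    nlinarith [hξ.2]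
  have coeff_le : altTaylorCoeff φ ξ (n + 1) * (ξ - s') ^ n ≤ φ s' / (s - s') := by
    rw [le_div_iff₀ hss']
    refine le_trans ?_ (hφ.term_le hs' (hs's.trans hξ.1) (n + 1))
    have : 0 ≤ ξ - s' := by linarith
    rw [pow_succ, ← mul_assoc]
    gcongr
    exact hξ.1.le
  calc _ = (n + 1) * (altTaylorCoeff φ ξ (n + 1) * (ξ - s) ^ n) * (t - s) := by rw [h]; ring
    _ ≤ (n + 1) * (altTaylorCoeff φ ξ (n + 1) * (q * (ξ - s')) ^ n) * (t - s) := by gcongr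
    _ = (n + 1) * (altTaylorCoeff φ ξ (n + 1) * (ξ - s') ^ n * q ^ n) * (t - s) := by
        rw [mul_pow]; ring
    _ ≤ (n + 1) * (φ s' / (s - s') * q ^ n) * (t - s) := by gcongr
    _ = _ := by ring

theorem hasSum_of_pos (hφ : IsCompletelyMonotone φ) (hs : 0 < s) (hst : s < t) :
    HasSum (fun n => altTaylorCoeff φ t n * (t - s) ^ n) (φ s) := by
  rw [hasSum_iff_tendsto_nat_of_nonneg (hφ.term_nonneg (hs.trans hst) hst.le),
    ← tendsto_add_atTop_iff_nat 1]
  set q := (t - s) / (t - s / 2) with hq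
  have hts' : 0 < t - s / 2 := by linarith
  have hq0 : 0 ≤ q := div_nonneg (sub_nonneg.2 hst.le) hts'.le
  have hq1 : q < 1 := by rw [hq, div_lt_one hts']; linarith
  have bound_tendsto : Tendsto (fun n : ℕ => φ (s / 2) * (t - s) / (s - s / 2) *
      ((n + 1) * q ^ n)) atTop (𝓝 0) := by
    have := (tendsto_self_mul_const_pow_of_lt_one hq0 hq1).add
      (tendsto_pow_atTop_nhds_zero_of_lt_one hq0 hq1)
    simpa only [add_mul, one_mul, add_zero, mul_zero] using
      this.const_mul (φ (s / 2) * (t - s) / (s - s / 2))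
  refine tendsto_of_tendsto_of_tendsto_of_le_of_le
    (by simpa only [sub_zero] using (tendsto_const_nhds (x := φ s)).sub bound_tendsto)
    tendsto_const_nhds (fun n => ?_) fun n => hφ.sum_le hs hst (n + 1)
  exact sub_le_comm.1 (hφ.remainder_le (half_pos hs) (half_lt_self hs) hst n)

theorem hasSum_zero (hφ : IsCompletelyMonotone φ) (hcont : ContinuousWithinAt φ (Ici 0) 0)
    (ht : 0 < t) : HasSum (fun n => altTaylorCoeff φ t n * t ^ n) (φ 0) := by
  have tendsto_zero : Tendsto φ (𝓝[>] 0) (𝓝 (φ 0)) :=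
    hcont.mono_left (nhdsWithin_mono _ Ioi_subset_Ici_self)
  have small : ∀ᶠ s in 𝓝[>] (0 : ℝ), 0 < s ∧ s < t := Ioo_mem_nhdsGT ht
  have sum_le (n : ℕ) : ∑ k ∈ Finset.range n, altTaylorCoeff φ t k * t ^ k ≤ φ 0 := by
    have : Tendsto (fun s => ∑ k ∈ Finset.range n, altTaylorCoeff φ t k * (t - s) ^ k)
        (𝓝[>] 0) (𝓝 (∑ k ∈ Finset.range n, altTaylorCoeff φ t k * (t - 0) ^ k)) :=
      (Continuous.tendsto (by fun_prop) 0).mono_left nhdsWithin_le_nhds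
    rw [sub_zero] at this
    exact le_of_tendsto_of_tendsto this tendsto_zero
      (small.mono fun s hs => hφ.sum_le hs.1 hs.2 n)
  have term_nonneg (n : ℕ) : 0 ≤ altTaylorCoeff φ t n * t ^ n := by
    simpa only [sub_zero] using hφ.term_nonneg ht ht.le n
  have summable := summable_of_sum_range_le term_nonneg sum_le
  have tsum_ge : φ 0 ≤ ∑' n, altTaylorCoeff φ t n * t ^ n := by
    refine le_of_tendsto tendsto_zero (small.mono fun s hs => ?_)
    refine hasSum_le (fun n => ?_) (hφ.hasSum_of_pos hs.1 hs.2) summable.hasSum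
    have := hφ.altTaylorCoeff_nonneg t ht n
    have : 0 ≤ t - s := sub_nonneg.2 hs.2.le
    gcongr
    linarith
  exact (summable.tsum_le_of_sum_range_le sum_le).antisymm tsum_ge ▸ summable.hasSum

theorem hasSum (hφ : IsCompletelyMonotone φ) (hcont : ContinuousWithinAt φ (Ici 0) 0)
    (hs : 0 ≤ s) (hst : s ≤ t) (ht : 0 < t) :
    HasSum (fun n => altTaylorCoeff φ t n * (t - s) ^ n) (φ s) := by
  rcases hst.eq_or_lt with rfl | hst
  · simpa [altTaylorCoeff_zero] using
      hasSum_single (f := fun n => altTaylorCoeff φ s n * (s - s) ^ n) 0 fun n hn => by simp [hn]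
  rcases hs.eq_or_lt with rfl | hs
  · simpa only [sub_zero] using hφ.hasSum_zero hcont ht
  · exact hφ.hasSum_of_pos hs hst

theorem antitoneOn (hφ : IsCompletelyMonotone φ) (hcont : ContinuousWithinAt φ (Ici 0) 0) :
    AntitoneOn φ (Ici 0) := by
  intro s hs t _ hst
  rcases hst.eq_or_lt with rfl | hst
  · rfl
  have ht := (mem_Ici.1 hs).trans_lt hst
  simpa [altTaylorCoeff_zero] using
    le_hasSum (hφ.hasSum hcont hs hst.le ht) 0 fun n _ => hφ.term_nonneg ht hst.le n

end IsCompletelyMonotone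

/-! ### Measures log-concave on balls -/

theorem liminf_rpow_mul_liminf_rpow_le {ι : Type*} {L : Filter ι} (f g : ι → ℝ≥0∞) {l : ℝ}
    (hl : 0 < l) (hl' : l < 1) :
    liminf f L ^ l * liminf g L ^ (1 - l) ≤ liminf (fun i => f i ^ l * g i ^ (1 - l)) L := by
  have liminf_rpow (u : ι → ℝ≥0∞) {p : ℝ} (hp : 0 < p) :
      liminf u L ^ p = liminf (fun i => u i ^ p) L := (ENNReal.orderIsoRpow p hp).liminf_apply
  rw [liminf_rpow f hl, liminf_rpow g (sub_pos.2 hl')]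
  exact ENNReal.le_liminf_mul

/-- Log-concavity of a measure tested on balls: for every fixed radius `h > 0`, the measure of the
ball with centre `x` and radius `h` is a log-concave function of `x`. The slack `ε`, by which the
radius may grow on the right-hand side, accommodates measures carried by a lattice of mesh
comparable to `ε`; the notion proper is the case `ε = 0`. -/
def IsLogConcaveOnBalls {E : Type*} [SeminormedAddCommGroup E] [NormedSpace ℝ E]
    [MeasurableSpace E] (ε : ℝ) (μ : Measure E) : Prop :=
  ∀ (x y : E) (h l : ℝ), 0 < h → 0 < l → l < 1 →
    μ (Metric.closedBall x h) ^ l * μ (Metric.closedBall y h) ^ (1 - l) ≤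
      μ (Metric.closedBall (l • x + (1 - l) • y) (h + ε))

theorem IsLogConcaveOnBalls.mono {E : Type*} [SeminormedAddCommGroup E] [NormedSpace ℝ E]
    [MeasurableSpace E] {ε ε' : ℝ} (hε : ε ≤ ε') {μ : Measure E} (hμ : IsLogConcaveOnBalls ε μ) :
    IsLogConcaveOnBalls ε' μ := fun x y h l hh hl hl' =>
  (hμ x y h l hh hl hl').trans (measure_mono (Metric.closedBall_subset_closedBall (by gcongr)))

theorem measure_le_liminf_thickening_of_tendsto {Ω ι : Type*} {L : Filter ι} [PseudoMetricSpace Ω]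
    [MeasurableSpace Ω] [OpensMeasurableSpace Ω] {μ : FiniteMeasure Ω} {μs : ι → FiniteMeasure Ω}
    (hlim : Tendsto μs L (𝓝 μ)) [L.NeBot] (s : Set Ω) {δ : ℝ} (hδ : 0 < δ) :
    (μ : Measure Ω) s ≤ liminf (fun i => (μs i : Measure Ω) (Metric.thickening δ s)) L := by
  have h := FiniteMeasure.tendsto_iff_forall_lintegral_tendsto.1 hlim (thickenedIndicator hδ s)
  calc (μ : Measure Ω) s ≤ (μ : Measure Ω) (closure s) := measure_mono subset_closure
    _ = ∫⁻ y, (closure s).indicator 1 y ∂μ := by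
        rw [lintegral_indicator_one isClosed_closure.measurableSet]
    _ ≤ ∫⁻ y, thickenedIndicator hδ s y ∂μ := by
        refine lintegral_mono (indicator_le' (fun y hy => ?_) fun _ _ => zero_le)
        simp [thickenedIndicator_one_of_mem_closure hδ s hy]
    _ = liminf (fun i => ∫⁻ y, thickenedIndicator hδ s y ∂(μs i)) L := h.liminf_eq.symm
    _ ≤ liminf (fun i => (μs i : Measure Ω) (Metric.thickening δ s)) L := by
        refine liminf_le_liminf (Eventually.of_forall fun i => ?_)
        rw [← lintegral_indicator_one Metric.isOpen_thickening.measurableSet]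
        refine lintegral_mono fun y => ?_
        by_cases hy : y ∈ Metric.thickening δ s
        · simpa [hy] using thickenedIndicator_le_one hδ s y
        · simp [hy, thickenedIndicator_zero hδ s hy]

theorem measure_closedBall_le_liminf_of_tendsto {E ι : Type*} {L : Filter ι}
    [SeminormedAddCommGroup E] [NormedSpace ℝ E] [MeasurableSpace E] [OpensMeasurableSpace E]
    {μ : FiniteMeasure E} {μs : ι → FiniteMeasure E} (hlim : Tendsto μs L (𝓝 μ)) [L.NeBot]
    (x : E) {h r : ℝ} (hh : 0 ≤ h) (hr : h < r) :
    (μ : Measure E) (Metric.closedBall x h) ≤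
      liminf (fun i => (μs i : Measure E) (Metric.closedBall x r)) L := by
  refine (measure_le_liminf_thickening_of_tendsto hlim _ (sub_pos.2 hr)).trans
    (liminf_le_liminf (Eventually.of_forall fun i => measure_mono ?_))
  rw [thickening_closedBall (sub_pos.2 hr) hh, sub_add_cancel]
  exact Metric.ball_subset_closedBall

theorem IsLogConcaveOnBalls.of_tendsto {E ι : Type*} {L : Filter ι} [SeminormedAddCommGroup E]
    [NormedSpace ℝ E] [MeasurableSpace E] [OpensMeasurableSpace E] {μ : FiniteMeasure E}
    {μs : ι → FiniteMeasure E} (hlim : Tendsto μs L (𝓝 μ)) [L.NeBot]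
    (H : ∀ ε > 0, ∀ᶠ i in L, IsLogConcaveOnBalls ε (μs i : Measure E)) :
    IsLogConcaveOnBalls 0 (μ : Measure E) := by
  intro x y h l hh hl hl'
  set z := l • x + (1 - l) • y
  have inter_eq : ⋂ r > h, Metric.closedBall z r = Metric.closedBall z h := by
    ext w
    simp only [mem_iInter, Metric.mem_closedBall]
    exact ⟨le_of_forall_gt_imp_ge_of_dense, fun hw r hr => hw.trans hr.le⟩
  have measure_tendsto := tendsto_measure_biInter_gt (μ := (μ : Measure E))
    (s := Metric.closedBall z) (a := h)
    (fun r _ => Metric.isClosed_closedBall.measurableSet.nullMeasurableSet)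
    (fun i j _ hij => Metric.closedBall_subset_closedBall hij)
    ⟨h + 1, lt_add_one h, measure_ne_top _ _⟩
  rw [inter_eq] at measure_tendsto
  rw [add_zero]
  refine ge_of_tendsto measure_tendsto ?_
  filter_upwards [self_mem_nhdsWithin] with r (hr : h < r)
  obtain ⟨s, hs, hsr⟩ := exists_between hr
  calc (μ : Measure E) (Metric.closedBall x h) ^ l *
        (μ : Measure E) (Metric.closedBall y h) ^ (1 - l)
      ≤ liminf (fun i => (μs i : Measure E) (Metric.closedBall x s)) L ^ l *
        liminf (fun i => (μs i : Measure E) (Metric.closedBall y s)) L ^ (1 - l) := by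
        have := sub_pos.2 hl'
        gcongr <;> exact measure_closedBall_le_liminf_of_tendsto hlim _ hh.le hs
    _ ≤ liminf (fun i => (μs i : Measure E) (Metric.closedBall z r)) L := by
        refine (liminf_rpow_mul_liminf_rpow_le _ _ hl hl').trans (liminf_le_liminf ?_)
        filter_upwards [H _ (sub_pos.2 hsr)] with i hi
        simpa only [add_sub_cancel] using
          hi x y s l (hh.trans hs) hl hl'
    _ ≤ limsup (fun i => (μs i : Measure E) (Metric.closedBall z r)) L := liminf_le_limsup
    _ ≤ (μ : Measure E) (Metric.closedBall z r) :=
        FiniteMeasure.limsup_measure_closed_le_of_tendsto hlim Metric.isClosed_closedBall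

/-- The measure on the line with atoms of mass `w n` at the points `n * δ`, for `n : ℤ`. -/
noncomputable def latticeMeasure (δ : ℝ) (w : ℤ → ℝ) : Measure ℝ :=
  Measure.sum fun n : ℤ => ENNReal.ofReal (w n) • Measure.dirac (n * δ)

theorem latticeMeasure_le_sum {δ : ℝ} (w : ℤ → ℝ) {s : Set ℝ} (hs : MeasurableSet s)
    {F : Finset ℤ} (H : ∀ n : ℤ, n * δ ∈ s → n ∈ F) :
    latticeMeasure δ w s ≤ ∑ n ∈ F, ENNReal.ofReal (w n) := by
  rw [latticeMeasure, Measure.sum_apply _ hs, tsum_eq_sum (s := F)]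
  · gcongr with n
    rw [Measure.smul_apply, smul_eq_mul]
    exact mul_le_of_le_one_right' prob_le_one
  · intro n hn
    rw [Measure.smul_apply, Measure.dirac_apply' _ hs,
      indicator_of_notMem fun h => hn (H n h), smul_zero]

theorem sum_le_latticeMeasure {δ : ℝ} (w : ℤ → ℝ) {s : Set ℝ} (hs : MeasurableSet s)
    {F : Finset ℤ} (H : ∀ n ∈ F, (n : ℝ) * δ ∈ s) :
    ∑ n ∈ F, ENNReal.ofReal (w n) ≤ latticeMeasure δ w s := by
  rw [latticeMeasure, Measure.sum_apply _ hs]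
  refine le_trans (Finset.sum_le_sum fun n hn => ?_) (ENNReal.sum_le_tsum F)
  rw [Measure.smul_apply, Measure.dirac_apply_of_mem (H n hn), smul_eq_mul, mul_one]

theorem latticeMeasure_closedBall_le {δ : ℝ} (hδ : 0 < δ) (w : ℤ → ℝ) (x : ℝ) {h : ℝ} {N : ℕ}
    (hN : 2 * h < N * δ) :
    latticeMeasure δ w (Metric.closedBall x h) ≤
      ∑ n ∈ Finset.Ico ⌈(x - h) / δ⌉ (⌈(x - h) / δ⌉ + N), ENNReal.ofReal (w n) := by
  refine latticeMeasure_le_sum w measurableSet_closedBall fun n hn => ?_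
  rw [Real.closedBall_eq_Icc] at hn
  refine Finset.mem_Ico.2 ⟨Int.ceil_le.2 ((div_le_iff₀ hδ).2 hn.1), ?_⟩
  have le_ceil : x - h ≤ ⌈(x - h) / δ⌉ * δ := (div_le_iff₀ hδ).1 (Int.le_ceil _)
  have : n * δ < (⌈(x - h) / δ⌉ + N) * δ := by linarith [hn.2]
  exact_mod_cast lt_of_mul_lt_mul_right this hδ.le

theorem le_latticeMeasure_closedBall {δ : ℝ} (hδ : 0 < δ) (w : ℤ → ℝ) {z r : ℝ} {k : ℤ} {N : ℕ}
    (hl : z - r ≤ k * δ) (hr : (k + N) * δ ≤ z + r + δ) :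
    ∑ n ∈ Finset.Ico k (k + N), ENNReal.ofReal (w n) ≤
      latticeMeasure δ w (Metric.closedBall z r) := by
  refine sum_le_latticeMeasure w measurableSet_closedBall fun n hn => ?_
  obtain ⟨hkn, hnk⟩ := Finset.mem_Ico.1 hn
  have hkn' : (k : ℝ) * δ ≤ n * δ := by gcongr
  have hnk' : ((n : ℝ) + 1) * δ ≤ (k + N) * δ :=
    mul_le_mul_of_nonneg_right (by exact_mod_cast hnk) hδ.le
  rw [Real.closedBall_eq_Icc]
  constructor <;> linarith

theorem IsPolyaFreqSeq.isLogConcaveOnBalls_latticeMeasure {w : ℤ → ℝ} (hw : IsPolyaFreqSeq w)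
    {δ : ℝ} (hδ : 0 < δ) : IsLogConcaveOnBalls (2 * δ) (latticeMeasure δ w) := by
  intro x y h l hh hl hl'
  set N : ℕ := ⌊2 * h / δ⌋₊ + 1 with hN
  have lt_N : 2 * h < N * δ := by
    rw [← div_lt_iff₀ hδ, hN, Nat.cast_succ]
    exact Nat.lt_floor_add_one _
  have N_le : N * δ ≤ 2 * h + δ := by
    have := (le_div_iff₀ hδ).1 (Nat.floor_le (show 0 ≤ 2 * h / δ by positivity))
    rw [hN, Nat.cast_succ]
    linarith
  set p : ℝ → ℤ := fun x => ⌈(x - h) / δ⌉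
  have le_p (x : ℝ) : x - h ≤ p x * δ := (div_le_iff₀ hδ).1 (Int.le_ceil _)
  have p_le (x : ℝ) : (p x - 1) * δ ≤ x - h :=
    (le_div_iff₀ hδ).1 (sub_le_iff_le_add.2 (Int.ceil_lt_add_one _).le)
  set W : ℤ → ℝ := fun p => ∑ n ∈ Finset.Ico p (p + N), w n
  have hW : IsPolyaFreqSeq W := hw.sum_Ico N
  have ofReal_W (p : ℤ) :
      ENNReal.ofReal (W p) = ∑ n ∈ Finset.Ico p (p + N), ENNReal.ofReal (w n) :=
    ENNReal.ofReal_sum_of_nonneg fun n _ => hw.nonneg n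
  have upper (x : ℝ) : latticeMeasure δ w (Metric.closedBall x h) ≤ ENNReal.ofReal (W (p x)) :=
    (latticeMeasure_closedBall_le hδ w x lt_N).trans_eq (ofReal_W _).symm
  obtain ⟨k, hk, hWk⟩ := hW.exists_rpow_mul_rpow_le (p x) (p y) hl hl'
  have lower : ENNReal.ofReal (W k) ≤
      latticeMeasure δ w (Metric.closedBall (l • x + (1 - l) • y) (h + 2 * δ)) := by
    rw [ofReal_W, smul_eq_mul, smul_eq_mul]
    rw [abs_le] at hk
    apply le_latticeMeasure_closedBall hδ <;> nlinarith [le_p x, le_p y, p_le x, p_le y]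
  calc _ ≤ ENNReal.ofReal (W (p x)) ^ l * ENNReal.ofReal (W (p y)) ^ (1 - l) := by
        have := sub_pos.2 hl'
        gcongr <;> exact upper _
    _ = ENNReal.ofReal (W (p x) ^ l * W (p y) ^ (1 - l)) := by
        rw [ENNReal.ofReal_rpow_of_nonneg (hW.nonneg _) hl.le,
          ENNReal.ofReal_rpow_of_nonneg (hW.nonneg _) (sub_pos.2 hl').le,
          ENNReal.ofReal_mul (Real.rpow_nonneg (hW.nonneg _) _)]
    _ ≤ ENNReal.ofReal (W k) := ENNReal.ofReal_le_ofReal hWk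
    _ ≤ _ := lower

/-! ### Laplace transforms -/

theorem hasSum_extendInt_mul {a : ℕ → ℝ} {f : ℤ → ℝ} {S : ℝ} :
    HasSum (fun n : ℤ => extendInt a n * f n) S ↔ HasSum (fun n : ℕ => a n * f n) S := by
  rw [← (Nat.cast_injective (R := ℤ)).hasSum_iff]
  · simp [Function.comp_def]
  · intro n hn
    have : n < 0 := by
      by_contra! h
      exact hn ⟨n.toNat, Int.toNat_of_nonneg h⟩
    rw [extendInt_of_neg a this, zero_mul]

theorem lintegral_latticeMeasure (δ : ℝ) (w : ℤ → ℝ) {f : ℝ → ℝ≥0∞} (hf : Measurable f) :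
    ∫⁻ x, f x ∂latticeMeasure δ w = ∑' n : ℤ, ENNReal.ofReal (w n) * f (n * δ) := by
  simp only [latticeMeasure, lintegral_sum_measure, lintegral_smul_measure, lintegral_dirac' _ hf,
    smul_eq_mul]

theorem isFiniteMeasure_latticeMeasure (δ : ℝ) {w : ℤ → ℝ} (hw : Summable w) :
    IsFiniteMeasure (latticeMeasure δ w) := by
  rw [isFiniteMeasure_iff, ← lintegral_one, lintegral_latticeMeasure δ w measurable_const]
  simpa only [mul_one] using hw.tsum_ofReal_lt_top

theorem integral_latticeMeasure (δ : ℝ) {w : ℤ → ℝ} (hw : ∀ n, 0 ≤ w n) {g : ℝ → ℝ}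
    (hg : Measurable g) (hg0 : ∀ x, 0 ≤ g x) {S : ℝ}
    (h : HasSum (fun n : ℤ => w n * g (n * δ)) S) : ∫ x, g x ∂latticeMeasure δ w = S := by
  have terms_nonneg (n : ℤ) : 0 ≤ w n * g (n * δ) := mul_nonneg (hw n) (hg0 _)
  rw [integral_eq_lintegral_of_nonneg_ae (ae_of_all _ hg0) hg.aestronglyMeasurable,
    lintegral_latticeMeasure δ w hg.ennreal_ofReal, ← h.tsum_eq]
  simp only [← ENNReal.ofReal_mul (hw _)]
  rw [← ENNReal.ofReal_tsum_of_nonneg terms_nonneg h.summable,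
    ENNReal.toReal_ofReal (tsum_nonneg terms_nonneg)]

theorem latticeMeasure_extendInt_Iio_zero {δ : ℝ} (hδ : 0 ≤ δ) (a : ℕ → ℝ) :
    latticeMeasure δ (extendInt a) (Iio 0) = 0 := by
  rw [latticeMeasure, Measure.sum_apply _ measurableSet_Iio, ENNReal.tsum_eq_zero]
  intro n
  rcases lt_or_ge n 0 with hn | hn
  · simp [extendInt_of_neg a hn]
  · have : 0 ≤ n * δ := mul_nonneg (Int.cast_nonneg hn) hδ
    simp [this]

theorem restrict_Ici_eq_self {μ : Measure ℝ} {a : ℝ} (h : μ (Iio a) = 0) :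
    μ.restrict (Ici a) = μ :=
  Measure.restrict_eq_self_of_ae_mem (by simpa [ae_iff, Iio_def] using h)

/-- The Laplace transform of the restriction of a measure to the half-line `[0, ∞)`. -/
noncomputable def laplaceTransform (μ : Measure ℝ) (u : ℝ) : ℝ :=
  ∫ x in Ici (0 : ℝ), Real.exp (-(u * x)) ∂μ

theorem laplaceTransform_eq_integral {μ : Measure ℝ} (hμ : μ (Iio 0) = 0) (u : ℝ) :
    laplaceTransform μ u = ∫ x, Real.exp (-(u * x)) ∂μ := by
  rw [laplaceTransform, restrict_Ici_eq_self hμ]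

theorem laplaceTransform_latticeMeasure_extendInt {δ : ℝ} (hδ : 0 ≤ δ) {a : ℕ → ℝ}
    (ha : ∀ n, 0 ≤ a n) {u S : ℝ} (h : HasSum (fun n => a n * Real.exp (-(u * (n * δ)))) S) :
    laplaceTransform (latticeMeasure δ (extendInt a)) u = S := by
  rw [laplaceTransform_eq_integral (latticeMeasure_extendInt_Iio_zero hδ a)]
  exact integral_latticeMeasure δ (extendInt_nonneg ha) (by fun_prop)
    (fun x => (Real.exp_pos _).le)
    ((hasSum_extendInt_mul (f := fun n => Real.exp (-(u * (n * δ))))).2 (by simpa using h))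

/-- The lattice measure with an atom of mass `t ^ n * a_t(n)` at `n / t`, whose Laplace transform
is the Taylor expansion of `φ` at `t`. -/
noncomputable def taylorMeasure (φ : ℝ → ℝ) (t : ℝ) : Measure ℝ :=
  latticeMeasure t⁻¹ (extendInt fun n => t ^ n * altTaylorCoeff φ t n)

theorem taylorMeasure_Iio_zero (φ : ℝ → ℝ) {t : ℝ} (ht : 0 ≤ t) : taylorMeasure φ t (Iio 0) = 0 :=
  latticeMeasure_extendInt_Iio_zero (inv_nonneg.2 ht) _

theorem IsLogConcaveSeq.isLogConcaveOnBalls_taylorMeasure {φ : ℝ → ℝ} {t : ℝ}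
    (h : IsLogConcaveSeq (altTaylorCoeff φ t)) (ht : 0 < t) :
    IsLogConcaveOnBalls (2 * t⁻¹) (taylorMeasure φ t) :=
  (h.pow_mul ht.le).isPolyaFreqSeq_extendInt.isLogConcaveOnBalls_latticeMeasure (inv_pos.2 ht)

namespace IsCompletelyMonotone

variable {φ : ℝ → ℝ} {t u : ℝ}

theorem hasSum_pow_mul_altTaylorCoeff (hφ : IsCompletelyMonotone φ)
    (hcont : ContinuousWithinAt φ (Ici 0) 0) (ht : 0 < t) (hu : 0 ≤ u) :
    HasSum (fun n => t ^ n * altTaylorCoeff φ t n * Real.exp (-(u * (n * t⁻¹))))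
      (φ (t * (1 - Real.exp (-(u / t))))) := by
  have exp_le : Real.exp (-(u / t)) ≤ 1 := Real.exp_le_one_iff.2 (neg_nonpos.2 (by positivity))
  have h := hφ.hasSum hcont (s := t * (1 - Real.exp (-(u / t)))) (t := t)
    (mul_nonneg ht.le (sub_nonneg.2 exp_le))
    (mul_le_of_le_one_right ht.le (sub_le_self _ (Real.exp_pos _).le)) ht
  refine h.congr_fun fun n => ?_
  rw [show t - t * (1 - Real.exp (-(u / t))) = t * Real.exp (-(u / t)) by ring, mul_pow,
    ← Real.exp_nat_mul]
  ring_nf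

theorem laplaceTransform_taylorMeasure (hφ : IsCompletelyMonotone φ)
    (hcont : ContinuousWithinAt φ (Ici 0) 0) (ht : 0 < t) (hu : 0 ≤ u) :
    laplaceTransform (taylorMeasure φ t) u = φ (t * (1 - Real.exp (-(u / t)))) :=
  laplaceTransform_latticeMeasure_extendInt (inv_nonneg.2 ht.le)
    (fun n => mul_nonneg (pow_nonneg ht.le n) (hφ.altTaylorCoeff_nonneg t ht n))
    (hφ.hasSum_pow_mul_altTaylorCoeff hcont ht hu)

theorem isFiniteMeasure_taylorMeasure (hφ : IsCompletelyMonotone φ)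
    (hcont : ContinuousWithinAt φ (Ici 0) 0) (ht : 0 < t) :
    IsFiniteMeasure (taylorMeasure φ t) := by
  refine isFiniteMeasure_latticeMeasure _ (HasSum.summable (a := φ 0) ?_)
  simpa using hasSum_extendInt_mul (f := 1).2
    (by simpa using hφ.hasSum_pow_mul_altTaylorCoeff hcont ht le_rfl)

theorem le_laplaceTransform_taylorMeasure (hφ : IsCompletelyMonotone φ)
    (hcont : ContinuousWithinAt φ (Ici 0) 0) (ht : 0 < t) (hu : 0 ≤ u) :
    φ u ≤ laplaceTransform (taylorMeasure φ t) u := by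
  have exp_le : Real.exp (-(u / t)) ≤ 1 := Real.exp_le_one_iff.2 (neg_nonpos.2 (by positivity))
  rw [hφ.laplaceTransform_taylorMeasure hcont ht hu]
  refine hφ.antitoneOn hcont (mul_nonneg ht.le (sub_nonneg.2 exp_le)) hu ?_
  calc t * (1 - Real.exp (-(u / t))) ≤ t * (u / t) := by
        gcongr
        linarith [Real.one_sub_le_exp_neg (u / t)]
    _ = u := mul_div_cancel₀ u ht.ne'

end IsCompletelyMonotone

theorem tendsto_mul_one_sub_exp_neg_div (u : ℝ) :
    Tendsto (fun t : ℝ => t * (1 - Real.exp (-(u / t)))) atTop (𝓝 u) := by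
  have hderiv : HasDerivAt (fun s : ℝ => 1 - Real.exp (-(u * s))) u 0 := by
    simpa using ((hasDerivAt_id' (0 : ℝ)).const_mul u).fun_neg.exp.const_sub 1
  refine ((hasDerivAt_iff_tendsto_slope.1 hderiv).comp
    (tendsto_inv_atTop_nhdsGT_zero.mono_right
      (nhdsWithin_mono _ fun x (hx : 0 < x) => hx.ne'))).congr fun t => ?_
  simp [slope_def_field, div_eq_mul_inv, mul_comm]

theorem integrable_exp_neg_mul_restrict_Ici (μ : Measure ℝ) [IsFiniteMeasure μ] {u : ℝ}
    (hu : 0 ≤ u) : Integrable (fun x => Real.exp (-(u * x))) (μ.restrict (Ici 0)) := by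
  refine Integrable.of_bound (by fun_prop) 1 ?_
  filter_upwards [ae_restrict_mem measurableSet_Ici] with x hx
  rw [Real.norm_eq_abs, Real.abs_exp, Real.exp_le_one_iff, neg_nonpos]
  exact mul_nonneg hu hx

theorem mul_measure_Ioi_le_laplaceTransform_sub (μ : Measure ℝ) [IsFiniteMeasure μ] {R : ℝ}
    (hR : 0 < R) :
    (1 - Real.exp (-1)) * μ.real (Ioi R) ≤ laplaceTransform μ 0 - laplaceTransform μ R⁻¹ := by
  have integrable_sub := (integrable_exp_neg_mul_restrict_Ici μ le_rfl).sub
    (integrable_exp_neg_mul_restrict_Ici μ (inv_nonneg.2 hR.le))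
  rw [laplaceTransform, laplaceTransform, ← integral_sub
    (integrable_exp_neg_mul_restrict_Ici μ le_rfl)
    (integrable_exp_neg_mul_restrict_Ici μ (inv_nonneg.2 hR.le))]
  calc (1 - Real.exp (-1)) * μ.real (Ioi R) = ∫ x in Ioi R, (1 - Real.exp (-1)) ∂μ := by
        rw [setIntegral_const, smul_eq_mul, mul_comm]
    _ ≤ ∫ x in Ioi R, (Real.exp (-(0 * x)) - Real.exp (-(R⁻¹ * x))) ∂μ := by
        have subset : Ioi R ⊆ Ici 0 := fun x hx => hR.le.trans (le_of_lt hx)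
        refine setIntegral_mono_on integrableOn_const
          (IntegrableOn.mono_set integrable_sub subset) measurableSet_Ioi fun x hx => ?_
        rw [zero_mul, neg_zero, Real.exp_zero]
        gcongr
        rw [inv_mul_eq_div, one_le_div hR]
        exact le_of_lt hx
    _ ≤ ∫ x in Ici 0, (Real.exp (-(0 * x)) - Real.exp (-(R⁻¹ * x))) ∂μ := by
        refine setIntegral_mono_set integrable_sub ?_
          (Eventually.of_forall fun x hx => hR.le.trans (le_of_lt hx))
        filter_upwards [ae_restrict_mem measurableSet_Ici] with x hx
        rw [Pi.zero_apply, zero_mul, sub_nonneg, Real.exp_le_exp, neg_le_neg_iff]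
        exact mul_nonneg (inv_nonneg.2 hR.le) hx

-- Near `0` the Laplace transform controls the tails, so its continuity there gives tightness.
theorem exists_tendsto_of_le_laplaceTransform {ι : Type*} (U : Ultrafilter ι)
    {μs : ι → FiniteMeasure ℝ} (hsupp : ∀ i, (μs i : Measure ℝ) (Iio 0) = 0) {φ : ℝ → ℝ}
    (hφ : ContinuousWithinAt φ (Ici 0) 0)
    (h_zero : ∀ i, laplaceTransform (μs i) 0 ≤ φ 0)
    (h_pos : ∀ i, ∀ u, 0 < u → φ u ≤ laplaceTransform (μs i) u) :
    ∃ μ, Tendsto μs U (𝓝 μ) := by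
  set R : ℕ → ℝ := fun n => n + 1
  have R_pos (n : ℕ) : 0 < R n := n.cast_add_one_pos
  set b : ℝ := 1 - Real.exp (-1)
  have hb : 0 < b := sub_pos.2 (Real.exp_lt_one_iff.2 (by norm_num))
  set τ : ℕ → ℝ≥0 := fun n => ((φ 0 - φ (R n)⁻¹) / b).toNNReal
  have τ_tendsto : Tendsto τ atTop (𝓝 0) := by
    have inv_tendsto : Tendsto (fun n => (R n)⁻¹) atTop (𝓝[≥] 0) :=
      tendsto_nhdsWithin_iff.2 ⟨by simpa [R] using tendsto_one_div_add_atTop_nhds_zero_nat (𝕜 := ℝ),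
        Eventually.of_forall fun n => (inv_pos.2 (R_pos n)).le⟩
    have h := ((hφ.tendsto.comp inv_tendsto).const_sub (φ 0)).div_const b
    rw [sub_self, zero_div] at h
    rw [← Real.toNNReal_zero]
    exact (continuous_real_toNNReal.tendsto 0).comp h
  have mass_le (i : ι) : (μs i).mass ≤ (φ 0).toNNReal := by
    have h := h_zero i
    rw [laplaceTransform_eq_integral (hsupp i)] at h
    simp only [zero_mul, neg_zero, Real.exp_zero, integral_const, smul_eq_mul, mul_one] at h
    exact NNReal.le_toNNReal_of_coe_le h
  have tail_le (i : ι) (n : ℕ) : μs i (Icc 0 (R n))ᶜ ≤ τ n := by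
    have h := (mul_measure_Ioi_le_laplaceTransform_sub (μs i) (R_pos n)).trans
      (sub_le_sub (h_zero i) (h_pos i _ (inv_pos.2 (R_pos n))))
    rw [mul_comm, ← le_div_iff₀ hb] at h
    refine NNReal.le_toNNReal_of_coe_le ?_
    calc (μs i : Measure ℝ).real (Icc 0 (R n))ᶜ
        ≤ (μs i : Measure ℝ).real (Iio 0) + (μs i : Measure ℝ).real (Ioi (R n)) := by
          rw [← Ici_inter_Iic, compl_inter, compl_Ici, compl_Iic]
          exact measureReal_union_le _ _
      _ = (μs i : Measure ℝ).real (Ioi (R n)) := by rw [measureReal_def, hsupp i]; simp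
      _ ≤ _ := h
  obtain ⟨μ, -, hμ⟩ := (isCompact_setOfPred_finiteMeasure_mass_le_compl_isCompact_le
    (φ 0).toNNReal τ_tendsto (fun n => isCompact_Icc (a := 0) (b := R n))
    (Or.inl inferInstance)).ultrafilter_le_nhds (U.map μs)
      (le_principal_iff.2 (Filter.mem_map.2 (univ_mem' fun i => ⟨mass_le i, tail_le i⟩)))
  exact ⟨μ, hμ⟩

theorem measure_eq_zero_of_tendsto_of_isOpen {Ω ι : Type*} {L : Filter ι} [PseudoMetricSpace Ω]
    [SecondCountableTopology Ω] [MeasurableSpace Ω] [OpensMeasurableSpace Ω] {μ : FiniteMeasure Ω}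
    {μs : ι → FiniteMeasure Ω} (hlim : Tendsto μs L (𝓝 μ)) [L.NeBot] {G : Set Ω} (hG : IsOpen G)
    (hμs : ∀ i, (μs i : Measure Ω) G = 0) : (μ : Measure Ω) G = 0 := by
  refine measure_null_of_locally_null G fun x hx => ?_
  obtain ⟨ε, hε, hball⟩ := Metric.isOpen_iff.1 hG x hx
  have thickening_subset : Metric.thickening (ε / 2) (Metric.ball x (ε / 2)) ⊆ G := by
    rw [← Metric.thickening_singleton]
    refine (Metric.thickening_thickening_subset _ _ _).trans ?_
    rwa [add_halves, Metric.thickening_singleton]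
  refine ⟨Metric.ball x (ε / 2), mem_nhdsWithin_of_mem_nhds (Metric.ball_mem_nhds x (half_pos hε)),
    le_antisymm ?_ zero_le⟩
  refine (measure_le_liminf_thickening_of_tendsto hlim _ (half_pos hε)).trans_eq ?_
  simp only [measure_mono_null thickening_subset (hμs _), liminf_const]

theorem tendsto_laplaceTransform {ι : Type*} {L : Filter ι} [L.NeBot] {μ : FiniteMeasure ℝ}
    {μs : ι → FiniteMeasure ℝ} (hlim : Tendsto μs L (𝓝 μ))
    (hsupp : ∀ i, (μs i : Measure ℝ) (Iio 0) = 0) {u : ℝ} (hu : 0 ≤ u) :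
    Tendsto (fun i => laplaceTransform (μs i) u) L (𝓝 (laplaceTransform μ u)) := by
  have integral_eq (ν : FiniteMeasure ℝ) (hν : (ν : Measure ℝ) (Iio 0) = 0) :
      ∫ x, Real.exp (-(u * max x 0)) ∂(ν : Measure ℝ) = laplaceTransform ν u := by
    rw [laplaceTransform_eq_integral hν]
    refine integral_congr_ae ?_
    have mem_Ici : ∀ᵐ x ∂(ν : Measure ℝ), 0 ≤ x := by simpa [ae_iff, Iio_def] using hν
    filter_upwards [mem_Ici] with x hx
    rw [max_eq_left hx]
  have norm_le (x : ℝ) : ‖Real.exp (-(u * max x 0))‖ ≤ 1 := by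
    rw [Real.norm_eq_abs, Real.abs_exp, Real.exp_le_one_iff, neg_nonpos]
    exact mul_nonneg hu (le_max_right x 0)
  have h := FiniteMeasure.tendsto_iff_forall_integral_tendsto.1 hlim
    (BoundedContinuousFunction.ofNormedAddCommGroup _ (by fun_prop) 1 norm_le)
  simp only [BoundedContinuousFunction.coe_ofNormedAddCommGroup] at h
  simpa only [integral_eq μ (measure_eq_zero_of_tendsto_of_isOpen hlim isOpen_Iio hsupp),
    integral_eq _ (hsupp _)] using h

/-! ### Lower densities -/

/-- The lower density of `μ` with respect to `ν` at a point, along shrinking closed balls. -/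
noncomputable def lowerDensity {α : Type*} [PseudoMetricSpace α] [MeasurableSpace α]
    (μ ν : Measure α) (x : α) : ℝ≥0∞ :=
  liminf (fun h => μ (Metric.closedBall x h) / ν (Metric.closedBall x h)) (𝓝[>] 0)

section Differentiation

variable {α : Type*} [MetricSpace α] [SecondCountableTopology α] [MeasurableSpace α] [BorelSpace α]
  [HasBesicovitchCovering α] (μ ν : Measure α) [IsLocallyFiniteMeasure μ] [IsLocallyFiniteMeasure ν]

theorem lowerDensity_ae_eq_rnDeriv : lowerDensity μ ν =ᵐ[ν] μ.rnDeriv ν := by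
  filter_upwards [Besicovitch.ae_tendsto_rnDeriv μ ν] with x hx using hx.liminf_eq

theorem lowerDensity_ae_eq_inv_rnDeriv [ν.IsOpenPosMeasure] :
    lowerDensity μ ν =ᵐ[μ] fun x => (ν.rnDeriv μ x)⁻¹ := by
  filter_upwards [Besicovitch.ae_tendsto_rnDeriv ν μ] with x hx
  have ball_lt_top : ∀ᶠ h in 𝓝[>] (0 : ℝ), ν (Metric.closedBall x h) < ⊤ :=
    nhdsWithin_le_nhds ((tendsto_closedBall_smallSets x).eventually (ν.finiteAt_nhds x).eventually)
  refine Tendsto.liminf_eq (((continuous_inv.tendsto _).comp hx).congr' ?_)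
  filter_upwards [self_mem_nhdsWithin, ball_lt_top] with h hh h_lt_top
  exact ENNReal.inv_div (Or.inr h_lt_top.ne) (Or.inr (Metric.measure_closedBall_pos ν x hh).ne')

theorem lowerDensity_pos_ae [ν.IsOpenPosMeasure] : ∀ᵐ x ∂μ, 0 < lowerDensity μ ν x := by
  filter_upwards [lowerDensity_ae_eq_inv_rnDeriv μ ν, Measure.rnDeriv_lt_top ν μ] with x hx hlt
  rw [hx]
  exact ENNReal.inv_pos.2 hlt.ne

theorem lowerDensity_ae_eq_top_of_measure_eq_zero [ν.IsOpenPosMeasure] {s : Set α}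
    (hs : MeasurableSet s) (hνs : ν s = 0) : ∀ᵐ x ∂μ, x ∈ s → lowerDensity μ ν x = ⊤ := by
  have rnDeriv_eq_zero : ∀ᵐ x ∂μ, x ∈ s → ν.rnDeriv μ x = 0 := by
    rw [← ae_restrict_iff' hs]
    have h := Measure.setLIntegral_rnDeriv_le (μ := ν) (ν := μ) s
    rwa [hνs, nonpos_iff_eq_zero, lintegral_eq_zero_iff (Measure.measurable_rnDeriv _ _)] at h
  filter_upwards [lowerDensity_ae_eq_inv_rnDeriv μ ν, rnDeriv_eq_zero] with x hx hx0 hxs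
  rw [hx, hx0 hxs, ENNReal.inv_zero]

theorem absolutelyContinuous_of_lowerDensity_ne_top [ν.IsOpenPosMeasure]
    (h : ∀ x, lowerDensity μ ν x ≠ ⊤) : μ ≪ ν := by
  refine Measure.AbsolutelyContinuous.mk fun s hs hνs => ?_
  rw [measure_eq_zero_iff_ae_notMem]
  filter_upwards [lowerDensity_ae_eq_top_of_measure_eq_zero μ ν hs hνs] with x hx hxs
  exact h x (hx hxs)

end Differentiation

theorem ennreal_div_rpow_mul_div_rpow (a b : ℝ≥0∞) {v : ℝ≥0∞} (hv : v ≠ 0) (hv' : v ≠ ⊤) {l : ℝ}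
    (hl : 0 ≤ l) (hl' : l ≤ 1) :
    (a / v) ^ l * (b / v) ^ (1 - l) = a ^ l * b ^ (1 - l) / v := by
  have h1l : 0 ≤ 1 - l := sub_nonneg.2 hl'
  have inv_eq : (v ^ l)⁻¹ * (v ^ (1 - l))⁻¹ = v⁻¹ := by
    rw [← ENNReal.mul_inv (Or.inr (by finiteness)) (Or.inl (by finiteness)),
      ← ENNReal.rpow_add _ _ hv hv', add_sub_cancel, ENNReal.rpow_one]
  rw [ENNReal.div_rpow_of_nonneg _ _ hl, ENNReal.div_rpow_of_nonneg _ _ h1l, div_eq_mul_inv,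
    div_eq_mul_inv, div_eq_mul_inv, ← inv_eq]
  ring

namespace IsLogConcaveOnBalls

theorem lowerDensity_rpow_mul_le {E : Type*} [NormedAddCommGroup E] [NormedSpace ℝ E]
    [FiniteDimensional ℝ E] [MeasurableSpace E] [BorelSpace E] {μ : Measure E}
    (hμ : IsLogConcaveOnBalls 0 μ) (ν : Measure E) [ν.IsAddHaarMeasure] (x y : E) {l : ℝ}
    (hl : 0 < l) (hl' : l < 1) :
    lowerDensity μ ν x ^ l * lowerDensity μ ν y ^ (1 - l) ≤
      lowerDensity μ ν (l • x + (1 - l) • y) := by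
  refine (liminf_rpow_mul_liminf_rpow_le _ _ hl hl').trans (liminf_le_liminf ?_)
  filter_upwards [self_mem_nhdsWithin] with h (hh : 0 < h)
  simp only [ν.addHaar_closedBall_center _ h]
  rw [ennreal_div_rpow_mul_div_rpow _ _ (Metric.measure_closedBall_pos ν 0 hh).ne'
    measure_closedBall_lt_top.ne hl.le hl'.le]
  gcongr
  simpa only [add_zero] using hμ x y h l hh hl hl'

variable {μ : Measure ℝ}

theorem lowerDensity_eq_zero [IsLocallyFiniteMeasure μ] (hμ : IsLogConcaveOnBalls 0 μ) {x y : ℝ}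
    (hx : lowerDensity μ volume x = ⊤) (hxy : y ≠ x) : lowerDensity μ volume y = 0 := by
  by_contra hy
  have eq_top : ∀ z ∈ openSegment ℝ x y, lowerDensity μ volume z = ⊤ := by
    rintro z ⟨a, b, ha, hb, hab, rfl⟩
    obtain rfl : b = 1 - a := by linarith
    have h := hμ.lowerDensity_rpow_mul_le volume x y ha (by linarith)
    rwa [hx, ENNReal.top_rpow_of_pos ha, ENNReal.top_mul, top_le_iff] at h
    simp [ENNReal.rpow_eq_zero_iff, hy, sub_nonneg.1 hb.le]
  have lt_top : ∀ᵐ z, lowerDensity μ volume z < ⊤ := by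
    filter_upwards [lowerDensity_ae_eq_rnDeriv μ volume, Measure.rnDeriv_lt_top μ volume]
      with z hz hz'
    rwa [hz]
  have null : volume (openSegment ℝ x y) = 0 :=
    measure_mono_null (fun z hz => by simp [eq_top z hz]) lt_top
  rw [openSegment_eq_Ioo' hxy.symm, Real.volume_Ioo, ENNReal.ofReal_eq_zero, sub_nonpos,
    max_le_iff, le_min_iff, le_min_iff] at null
  exact hxy (le_antisymm null.2.1 null.1.2)

theorem eq_smul_dirac [IsLocallyFiniteMeasure μ] (hμ : IsLogConcaveOnBalls 0 μ) {x : ℝ}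
    (hx : lowerDensity μ volume x = ⊤) : μ = μ {x} • Measure.dirac x := by
  have compl_null : μ {x}ᶜ = 0 :=
    measure_mono_null (fun y hy => by simp [hμ.lowerDensity_eq_zero hx hy])
      (lowerDensity_pos_ae μ volume)
  rw [← Measure.restrict_singleton]
  exact (Measure.restrict_eq_self_of_ae_mem compl_null).symm

theorem isLogConcaveOn_toReal_lowerDensity (hμ : IsLogConcaveOnBalls 0 μ)
    (hlt : ∀ x, lowerDensity μ volume x ≠ ⊤) {K : Set ℝ} (hK : Convex ℝ K) :
    IsLogConcaveOn K fun x => (lowerDensity μ volume x).toReal := by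
  refine ⟨hK, fun _ _ => ENNReal.toReal_nonneg, fun x _ y _ l hl hl' => ?_⟩
  rw [ENNReal.toReal_rpow, ENNReal.toReal_rpow, ← ENNReal.toReal_mul]
  exact ENNReal.toReal_mono (hlt _) (hμ.lowerDensity_rpow_mul_le volume x y hl hl')

-- A point of infinite density forces the density to vanish at every other point, since otherwise
-- it would be infinite on a whole interval.
theorem isLogConcaveMeasureOnHalfLine [IsFiniteMeasure μ] (hμ : IsLogConcaveOnBalls 0 μ)
    (hsupp : μ (Iio 0) = 0) : IsLogConcaveMeasureOnHalfLine μ := by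
  by_cases htop : ∃ x, lowerDensity μ volume x = ⊤
  · left
    obtain ⟨x, hx⟩ := htop
    have hdirac := hμ.eq_smul_dirac hx
    rcases lt_or_ge x 0 with hx0 | hx0
    · refine ⟨0, 0, le_rfl, ?_⟩
      have hx_null : μ {x} = 0 := measure_mono_null (singleton_subset_iff.2 (mem_Iio.2 hx0)) hsupp
      rwa [hx_null, zero_smul, ← zero_smul ℝ≥0 (Measure.dirac 0)] at hdirac
    · refine ⟨(μ {x}).toNNReal, x, hx0, ?_⟩
      rwa [ENNReal.smul_def, ENNReal.coe_toNNReal (measure_ne_top μ _)]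
  · right
    push Not at htop
    refine ⟨_, hμ.isLogConcaveOn_toReal_lowerDensity htop (convex_Ici 0), ?_⟩
    simp_rw [ENNReal.ofReal_toReal (htop _)]
    rw [← restrict_withDensity measurableSet_Ici,
      withDensity_congr_ae (lowerDensity_ae_eq_rnDeriv μ volume),
      Measure.withDensity_rnDeriv_eq μ volume
        (absolutelyContinuous_of_lowerDensity_ne_top μ volume htop), restrict_Ici_eq_self hsupp]

end IsLogConcaveOnBalls

theorem IsCompletelyMonotone.tendsto_laplaceTransform_taylorMeasure {φ : ℝ → ℝ}
    (hφ : IsCompletelyMonotone φ) (hcont : ContinuousOn φ (Ici 0)) {u : ℝ} (hu : 0 ≤ u) :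
    Tendsto (fun t => laplaceTransform (taylorMeasure φ t) u) atTop (𝓝 (φ u)) := by
  have arg_mem : ∀ᶠ t in atTop, t * (1 - Real.exp (-(u / t))) ∈ Ici 0 := by
    filter_upwards [eventually_gt_atTop 0] with t ht
    exact mul_nonneg ht.le (sub_nonneg.2 (Real.exp_le_one_iff.2 (neg_nonpos.2 (by positivity))))
  refine ((hcont u hu).tendsto.comp (tendsto_nhdsWithin_iff.2
    ⟨tendsto_mul_one_sub_exp_neg_div u, arg_mem⟩)).congr' ?_
  filter_upwards [eventually_gt_atTop 0] with t ht
  exact (hφ.laplaceTransform_taylorMeasure (hcont 0 self_mem_Ici) ht hu).symm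

theorem exists_isLogConcaveMeasureOnHalfLine {φ : ℝ → ℝ} (hcont : ContinuousOn φ (Ici 0))
    (hsmooth : ContDiffOn ℝ ∞ φ (Ioi 0))
    (hlc : ∀ t, 0 < t → IsLogConcaveSeq (altTaylorCoeff φ t)) :
    ∃ μ : Measure ℝ, IsFiniteMeasure μ ∧ IsLogConcaveMeasureOnHalfLine μ ∧
      ∀ u, 0 ≤ u → φ u = laplaceTransform μ u := by
  have hφ : IsCompletelyMonotone φ := ⟨hsmooth, fun t ht => (hlc t ht).1⟩
  have hcont_zero : ContinuousWithinAt φ (Ici 0) 0 := hcont 0 self_mem_Ici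
  set t : ℕ → ℝ := fun n => n + 1
  have t_pos (n : ℕ) : 0 < t n := n.cast_add_one_pos
  have t_tendsto : Tendsto t (hyperfilter ℕ) atTop :=
    (tendsto_atTop_add_const_right _ _ tendsto_natCast_atTop_atTop).mono_left
      Nat.hyperfilter_le_atTop
  set μs : ℕ → FiniteMeasure ℝ := fun n =>
    ⟨taylorMeasure φ (t n), hφ.isFiniteMeasure_taylorMeasure hcont_zero (t_pos n)⟩
  have hsupp (n : ℕ) : (μs n : Measure ℝ) (Iio 0) = 0 := taylorMeasure_Iio_zero φ (t_pos n).le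
  obtain ⟨μ, hlim⟩ := exists_tendsto_of_le_laplaceTransform (hyperfilter ℕ) hsupp hcont_zero
    (fun n => (hφ.laplaceTransform_taylorMeasure hcont_zero (t_pos n) le_rfl).trans_le (by simp))
    (fun n u hu => hφ.le_laplaceTransform_taylorMeasure hcont_zero (t_pos n) hu.le)
  have isLogConcaveOnBalls : IsLogConcaveOnBalls 0 (μ : Measure ℝ) := by
    refine IsLogConcaveOnBalls.of_tendsto hlim fun ε hε => ?_
    filter_upwards [t_tendsto.eventually_ge_atTop (2 / ε)] with n hn
    refine ((hlc _ (t_pos n)).isLogConcaveOnBalls_taylorMeasure (t_pos n)).mono ?_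
    rwa [← div_eq_mul_inv, div_le_comm₀ (t_pos n) hε]
  refine ⟨μ, inferInstance, isLogConcaveOnBalls.isLogConcaveMeasureOnHalfLine
    (measure_eq_zero_of_tendsto_of_isOpen hlim isOpen_Iio hsupp), fun u hu => ?_⟩
  exact tendsto_nhds_unique
    ((hφ.tendsto_laplaceTransform_taylorMeasure hcont hu).comp t_tendsto)
    (tendsto_laplaceTransform hlim hsupp hu)

/-! ### Moments of log-concave densities -/

namespace IsLogConcaveOn

variable {E : Type*} [AddCommGroup E] [Module ℝ E] {K : Set E} {f g : E → ℝ}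

theorem mono (hf : IsLogConcaveOn K f) {K' : Set E} (hK' : Convex ℝ K') (h : K' ⊆ K) :
    IsLogConcaveOn K' f :=
  ⟨hK', fun x hx => hf.2.1 x (h hx), fun x hx y hy => hf.2.2 x (h hx) y (h hy)⟩

theorem mul (hf : IsLogConcaveOn K f) (hg : IsLogConcaveOn K g) :
    IsLogConcaveOn K fun x => f x * g x := by
  refine ⟨hf.1, fun x hx => mul_nonneg (hf.2.1 x hx) (hg.2.1 x hx), fun x hx y hy l hl hl' => ?_⟩
  have hz := hf.1 hx hy hl.le (sub_nonneg.2 hl'.le) (add_sub_cancel _ _)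
  rw [Real.mul_rpow (hf.2.1 x hx) (hg.2.1 x hx), Real.mul_rpow (hf.2.1 y hy) (hg.2.1 y hy),
    mul_mul_mul_comm]
  exact mul_le_mul (hf.2.2 x hx y hy l hl hl') (hg.2.2 x hx y hy l hl hl')
    (mul_nonneg (Real.rpow_nonneg (hg.2.1 x hx) _) (Real.rpow_nonneg (hg.2.1 y hy) _))
    (hf.2.1 _ hz)

theorem quasiconcaveOn (hf : IsLogConcaveOn K f) : QuasiconcaveOn ℝ K f := by
  refine quasiconcaveOn_iff_min_le.2 ⟨hf.1, fun x hx y hy a b ha hb hab => ?_⟩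
  rcases ha.eq_or_lt with rfl | ha
  · simp [show b = 1 by linarith]
  rcases hb.eq_or_lt with rfl | hb
  · simp [show a = 1 by linarith]
  obtain rfl : b = 1 - a := by linarith
  have min_nonneg : 0 ≤ min (f x) (f y) := le_min (hf.2.1 x hx) (hf.2.1 y hy)
  calc min (f x) (f y) = min (f x) (f y) ^ a * min (f x) (f y) ^ (1 - a) := by
        rw [← Real.rpow_add' min_nonneg (by simp), add_sub_cancel, Real.rpow_one]
    _ ≤ f x ^ a * f y ^ (1 - a) := by
        gcongr
        exacts [Real.rpow_nonneg (hf.2.1 x hx) a, min_le_left _ _, min_le_right _ _]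
    _ ≤ f (a • x + (1 - a) • y) := hf.2.2 x hx y hy a ha (by linarith)

end IsLogConcaveOn

theorem isLogConcaveOn_exp_neg_mul {K : Set ℝ} (hK : Convex ℝ K) (t : ℝ) :
    IsLogConcaveOn K fun x => Real.exp (-(t * x)) := by
  refine ⟨hK, fun x _ => (Real.exp_pos _).le, fun x _ y _ l _ _ => le_of_eq ?_⟩
  rw [← Real.exp_mul, ← Real.exp_mul, ← Real.exp_add, smul_eq_mul, smul_eq_mul]
  ring_nf

theorem IsLogConcaveOn.aemeasurable {K : Set ℝ} {f : ℝ → ℝ} (hf : IsLogConcaveOn K f) :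
    AEMeasurable f (volume.restrict K) := by
  rw [← aemeasurable_indicator_iff hf.1.ordConnected.measurableSet]
  refine (measurable_of_Ioi fun c => ?_).aemeasurable
  rcases lt_or_ge c 0 with hc | hc
  · convert MeasurableSet.univ
    exact eq_univ_of_forall fun x => hc.trans_le (indicator_nonneg hf.2.1 x)
  · convert (hf.quasiconcaveOn.convex_gt c).ordConnected.measurableSet
    ext x
    by_cases hx : x ∈ K <;> simp [hx, hc]

theorem IsLogConcaveOn.convex_sub_exp_pos {K : Set ℝ} {f : ℝ → ℝ} (hf : IsLogConcaveOn K f)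
    (α β : ℝ) : Convex ℝ {x ∈ K | 0 < f x - α * Real.exp (-(β * x))} := by
  have tilted := hf.mul (isLogConcaveOn_exp_neg_mul hf.1 (-β))
  have sub_pos_iff (x : ℝ) :
      0 < f x - α * Real.exp (-(β * x)) ↔ α < f x * Real.exp (-(-β * x)) := by
    rw [sub_pos, neg_mul, neg_neg, Real.exp_neg, ← div_eq_mul_inv, div_lt_iff₀ (Real.exp_pos _)]
  simpa only [sub_pos_iff] using tilted.quasiconcaveOn.convex_gt α

theorem exists_sub_mul_sub_mul_nonpos_or_exists_sub_mul_nonneg {h : ℝ → ℝ}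
    (hS : Convex ℝ {x ∈ Ioi 0 | 0 < h x}) :
    (∃ a b, 0 < a + b ∧ ∀ x ∈ Ioi 0, (x - a) * (x - b) * h x ≤ 0) ∨
      ∃ a, ∀ x ∈ Ioi 0, 0 ≤ (x - a) * h x := by
  set S := {x ∈ Ioi 0 | 0 < h x}
  have nonpos_of_notMem {x : ℝ} (hx : x ∈ Ioi 0) (hxS : x ∉ S) : h x ≤ 0 :=
    not_lt.1 fun hlt => hxS ⟨hx, hlt⟩
  have hbelow : BddBelow S := ⟨0, fun x hx => le_of_lt hx.1⟩
  by_cases habove : BddAbove S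
  · left
    rcases S.eq_empty_or_nonempty with hempty | hne
    · exact ⟨1, 1, by norm_num, fun x hx => mul_nonpos_of_nonneg_of_nonpos (mul_self_nonneg _)
        (nonpos_of_notMem hx (by simp [hempty]))⟩
    refine ⟨sInf S, sSup S, ?_, fun x hx => ?_⟩
    · obtain ⟨x, hx⟩ := hne
      exact add_pos_of_nonneg_of_pos (Real.sInf_nonneg fun y hy => le_of_lt hy.1)
        (lt_of_lt_of_le hx.1 (le_csSup habove hx))
    by_cases hxS : x ∈ S
    · exact mul_nonpos_of_nonpos_of_nonneg (mul_nonpos_of_nonneg_of_nonpos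
        (sub_nonneg.2 (csInf_le hbelow hxS)) (sub_nonpos.2 (le_csSup habove hxS))) hxS.2.le
    · refine mul_nonpos_of_nonneg_of_nonpos ?_ (nonpos_of_notMem hx hxS)
      have notMem_Ioo := fun hmem =>
        hxS (IsConnected.Ioo_csInf_csSup_subset ⟨hne, hS.isPreconnected⟩ hbelow habove hmem)
      rcases le_or_gt x (sInf S) with hle | hlt
      · exact mul_nonneg_of_nonpos_of_nonpos (sub_nonpos.2 hle)
          (sub_nonpos.2 (hle.trans (csInf_le_csSup hne hbelow habove)))
      · exact mul_nonneg (sub_nonneg.2 hlt.le)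
          (sub_nonneg.2 (not_lt.1 fun hlt' => notMem_Ioo ⟨hlt, hlt'⟩))
  · right
    refine ⟨sInf S, fun x hx => ?_⟩
    by_cases hxS : x ∈ S
    · exact mul_nonneg (sub_nonneg.2 (csInf_le hbelow hxS)) hxS.2.le
    · refine mul_nonneg_of_nonpos_of_nonpos (sub_nonpos.2 (not_lt.1 fun hlt => hxS ?_))
        (nonpos_of_notMem hx hxS)
      exact hS.isPreconnected.Ioi_csInf_subset hbelow habove hlt

theorem integral_pow_mul_nonneg_of_convex {h : ℝ → ℝ} {n : ℕ}
    (hS : Convex ℝ {x ∈ Ioi 0 | 0 < h x})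
    (h_int : ∀ k, IntegrableOn (fun x => x ^ k * h x) (Ioi 0))
    (h_n : ∫ x in Ioi (0 : ℝ), x ^ n * h x = 0)
    (h_n2 : ∫ x in Ioi (0 : ℝ), x ^ (n + 2) * h x = 0) :
    0 ≤ ∫ x in Ioi (0 : ℝ), x ^ (n + 1) * h x := by
  rcases exists_sub_mul_sub_mul_nonpos_or_exists_sub_mul_nonneg hS with
    ⟨a, b, hab, hle⟩ | ⟨a, hle⟩
  · have integral_eq : ∫ x in Ioi (0 : ℝ), x ^ n * ((x - a) * (x - b) * h x) =
        -((a + b) * ∫ x in Ioi (0 : ℝ), x ^ (n + 1) * h x) := by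
      have expand (x : ℝ) : x ^ n * ((x - a) * (x - b) * h x) =
          x ^ (n + 2) * h x - (a + b) * (x ^ (n + 1) * h x) + a * b * (x ^ n * h x) := by ring
      simp only [expand]
      rw [integral_add ((h_int _).fun_sub ((h_int _).const_mul _)) ((h_int _).const_mul _),
        integral_sub (h_int _) ((h_int _).const_mul _), integral_const_mul, integral_const_mul, h_n,
        h_n2]
      ring
    have integral_nonpos : ∫ x in Ioi (0 : ℝ), x ^ n * ((x - a) * (x - b) * h x) ≤ 0 :=
      setIntegral_nonpos measurableSet_Ioi fun x hx =>
        mul_nonpos_of_nonneg_of_nonpos (pow_nonneg (le_of_lt hx) n) (hle x hx)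
    rw [integral_eq, neg_nonpos] at integral_nonpos
    exact nonneg_of_mul_nonneg_right integral_nonpos hab
  · have integral_eq : ∫ x in Ioi (0 : ℝ), x ^ n * ((x - a) * h x) =
        ∫ x in Ioi (0 : ℝ), x ^ (n + 1) * h x := by
      have expand (x : ℝ) :
          x ^ n * ((x - a) * h x) = x ^ (n + 1) * h x - a * (x ^ n * h x) := by ring
      simp only [expand]
      rw [integral_sub (h_int _) ((h_int _).const_mul _), integral_const_mul, h_n, mul_zero,
        sub_zero]
    rw [← integral_eq]
    exact setIntegral_nonneg measurableSet_Ioi fun x hx =>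
      mul_nonneg (pow_nonneg (le_of_lt hx) n) (hle x hx)

theorem integrableOn_pow_mul_exp_neg_mul {β : ℝ} (hβ : 0 < β) (n : ℕ) :
    IntegrableOn (fun x => x ^ n * Real.exp (-(β * x))) (Ioi 0) := by
  simpa using integrableOn_rpow_mul_exp_neg_mul_rpow (p := 1) (s := n) (b := β)
    (by linarith [n.cast_nonneg (α := ℝ)]) one_pos hβ

theorem integral_pow_mul_exp_neg_mul {β : ℝ} (hβ : 0 < β) (n : ℕ) :
    ∫ x in Ioi (0 : ℝ), x ^ n * Real.exp (-(β * x)) = n.factorial / β ^ (n + 1) := by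
  have h := Real.integral_rpow_mul_exp_neg_mul_Ioi (a := n + 1) (r := β) (by positivity) hβ
  simp only [Real.Gamma_nat_eq_factorial, add_sub_cancel_right, Real.rpow_natCast] at h
  rw [h, one_div, ← Nat.cast_succ, Real.rpow_natCast, inv_pow, mul_comm, div_eq_mul_inv]

/-- The moment of order `n` on `(0, ∞)` of the density `f`, divided by `n !`. This normalization
turns the moments of `exp (-β x)` into a geometric sequence. -/
noncomputable def normalizedMoment (f : ℝ → ℝ) (n : ℕ) : ℝ :=
  (∫ x in Ioi (0 : ℝ), x ^ n * f x) / n.factorial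

theorem integral_pow_mul_eq_normalizedMoment_mul (f : ℝ → ℝ) (n : ℕ) :
    ∫ x in Ioi (0 : ℝ), x ^ n * f x = normalizedMoment f n * n.factorial :=
  (div_mul_cancel₀ _ (by positivity)).symm

theorem integral_pow_mul_sub_exp {f : ℝ → ℝ} {n : ℕ}
    (h_int : IntegrableOn (fun x => x ^ n * f x) (Ioi 0)) (α : ℝ) {β : ℝ} (hβ : 0 < β) :
    ∫ x in Ioi (0 : ℝ), x ^ n * (f x - α * Real.exp (-(β * x))) =
      (normalizedMoment f n - α / β ^ (n + 1)) * n.factorial := by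
  simp only [mul_sub, mul_left_comm _ α]
  rw [integral_sub h_int ((integrableOn_pow_mul_exp_neg_mul hβ n).const_mul α), integral_const_mul,
    integral_pow_mul_exp_neg_mul hβ, integral_pow_mul_eq_normalizedMoment_mul]
  ring

theorem exists_div_pow_eq_div_pow_eq {p q : ℝ} (hp : 0 < p) (hq : 0 < q) (n : ℕ) :
    ∃ α β : ℝ, 0 < β ∧ α / β ^ n = p ∧ α / β ^ (n + 2) = q := by
  have hβ : 0 < √(p / q) := Real.sqrt_pos.2 (div_pos hp hq)
  refine ⟨p * √(p / q) ^ n, √(p / q), hβ, by field_simp, ?_⟩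
  rw [pow_add, Real.sq_sqrt (div_pos hp hq).le]
  field_simp

namespace IsLogConcaveOn

variable {f : ℝ → ℝ}

-- Compare `f` with the exponential `α * exp (-β x)` having the same moments of orders `n` and
-- `n + 2`: it is exceeded by `f` exactly on an interval, hence has a smaller moment of order
-- `n + 1`.
theorem normalizedMoment_mul_le (hf : IsLogConcaveOn (Ioi 0) f)
    (h_int : ∀ k : ℕ, IntegrableOn (fun x => x ^ k * f x) (Ioi 0))
    (hpos : ∀ k, 0 < normalizedMoment f k) (n : ℕ) :
    normalizedMoment f n * normalizedMoment f (n + 2) ≤ normalizedMoment f (n + 1) ^ 2 := by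
  obtain ⟨α, β, hβ, h_n, h_n2⟩ := exists_div_pow_eq_div_pow_eq (hpos n) (hpos (n + 2)) (n + 1)
  have h_int_sub (k : ℕ) :
      IntegrableOn (fun x => x ^ k * (f x - α * Real.exp (-(β * x)))) (Ioi 0) := by
    simp only [mul_sub, mul_left_comm _ α]
    exact (h_int k).sub ((integrableOn_pow_mul_exp_neg_mul hβ k).const_mul α)
  have moment_le : α / β ^ (n + 2) ≤ normalizedMoment f (n + 1) := by
    have h := integral_pow_mul_nonneg_of_convex (n := n) (hf.convex_sub_exp_pos α β) h_int_sub
      (by rw [integral_pow_mul_sub_exp (h_int _) α hβ, h_n, sub_self, zero_mul])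
      (by rw [integral_pow_mul_sub_exp (h_int _) α hβ, h_n2, sub_self, zero_mul])
    rw [integral_pow_mul_sub_exp (h_int _) α hβ] at h
    exact sub_nonneg.1 (nonneg_of_mul_nonneg_left h (by positivity))
  have α_pos : 0 < α := by
    have := hpos n
    rw [← h_n] at this
    exact (div_pos_iff_of_pos_right (by positivity)).1 this
  calc normalizedMoment f n * normalizedMoment f (n + 2) = (α / β ^ (n + 2)) ^ 2 := by
        rw [← h_n, ← h_n2]
        field_simp
        ring
    _ ≤ normalizedMoment f (n + 1) ^ 2 := by gcongr

theorem isLogConcaveSeq_normalizedMoment (hf : IsLogConcaveOn (Ioi 0) f)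
    (h_int : ∀ k : ℕ, IntegrableOn (fun x => x ^ k * f x) (Ioi 0)) :
    IsLogConcaveSeq (normalizedMoment f) := by
  by_cases hzero : f =ᵐ[volume.restrict (Ioi 0)] 0
  · have moment_zero (n : ℕ) : normalizedMoment f n = 0 := by
      rw [normalizedMoment, integral_eq_zero_of_ae, zero_div]
      filter_upwards [hzero] with x hx
      rw [hx, Pi.zero_apply, mul_zero]
    refine isLogConcaveSeq_iff.2 ⟨fun n => (moment_zero n).ge, fun p q _ => ?_⟩
    simp only [moment_zero, mul_zero, le_rfl]
  have integrand_nonneg (n : ℕ) : 0 ≤ᵐ[volume.restrict (Ioi 0)] fun x => x ^ n * f x := by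
    filter_upwards [ae_restrict_mem measurableSet_Ioi] with x hx
    exact mul_nonneg (pow_nonneg (le_of_lt hx) n) (hf.2.1 x hx)
  have moment_pos (n : ℕ) : 0 < normalizedMoment f n := by
    refine div_pos ((integral_nonneg_of_ae (integrand_nonneg n)).lt_of_ne' fun h => hzero ?_)
      (by positivity)
    rw [integral_eq_zero_iff_of_nonneg_ae (integrand_nonneg n) (h_int n)] at h
    filter_upwards [h, ae_restrict_mem measurableSet_Ioi] with x hx (hx_pos : 0 < x)
    exact (mul_eq_zero_iff_left (pow_ne_zero n hx_pos.ne')).1 hx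
  exact isLogConcaveSeq_of_pos moment_pos (hf.normalizedMoment_mul_le h_int moment_pos)

end IsLogConcaveOn

section LaplaceTransform

variable {μ : Measure ℝ} {t : ℝ}

theorem laplaceTransform_eq_mgf (μ : Measure ℝ) :
    laplaceTransform μ = ProbabilityTheory.mgf (fun x => -x) (μ.restrict (Ici 0)) := by
  ext u
  simp only [laplaceTransform, ProbabilityTheory.mgf, mul_neg]

theorem mem_interior_integrableExpSet_neg [IsFiniteMeasure μ] (ht : 0 < t) :
    t ∈ interior (ProbabilityTheory.integrableExpSet (fun x => -x) (μ.restrict (Ici 0))) := by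
  have subset : Ici 0 ⊆ ProbabilityTheory.integrableExpSet (fun x => -x) (μ.restrict (Ici 0)) :=
    fun u hu => by
      simpa only [ProbabilityTheory.integrableExpSet, mul_neg, mem_ofPred_eq] using
        integrable_exp_neg_mul_restrict_Ici μ hu
  exact interior_mono subset (by rwa [interior_Ici])

theorem neg_one_pow_mul_neg_pow_mul_exp (t x : ℝ) (n : ℕ) :
    (-1) ^ n * ((-x) ^ n * Real.exp (t * -x)) = x ^ n * Real.exp (-(t * x)) := by
  rw [← mul_assoc, ← mul_pow, neg_one_mul, neg_neg, mul_neg]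

theorem integrableOn_pow_mul_exp_neg_mul_Ici [IsFiniteMeasure μ] (ht : 0 < t) (n : ℕ) :
    IntegrableOn (fun x => x ^ n * Real.exp (-(t * x))) (Ici 0) μ := by
  simpa only [IntegrableOn, neg_one_pow_mul_neg_pow_mul_exp] using
    (ProbabilityTheory.integrable_pow_mul_exp_of_mem_interior_integrableExpSet
      (mem_interior_integrableExpSet_neg ht) n).const_mul ((-1) ^ n)

theorem altTaylorCoeff_laplaceTransform [IsFiniteMeasure μ] (ht : 0 < t) (n : ℕ) :
    altTaylorCoeff (laplaceTransform μ) t n =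
      (∫ x in Ici (0 : ℝ), x ^ n * Real.exp (-(t * x)) ∂μ) / n.factorial := by
  rw [altTaylorCoeff, laplaceTransform_eq_mgf,
    ProbabilityTheory.iteratedDeriv_mgf (mem_interior_integrableExpSet_neg ht),
    ← integral_const_mul]
  simp only [neg_one_pow_mul_neg_pow_mul_exp]

end LaplaceTransform

theorem isLogConcaveSeq_altTaylorCoeff_laplaceTransform_smul_dirac (c : ℝ≥0) {x₀ t : ℝ}
    (hx₀ : 0 ≤ x₀) (ht : 0 < t) :
    IsLogConcaveSeq (altTaylorCoeff (laplaceTransform (c • Measure.dirac x₀)) t) := by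
  convert (isLogConcaveSeq_inv_factorial.pow_mul hx₀).const_mul
    (c := c * Real.exp (-(t * x₀))) (by positivity) with n
  rw [altTaylorCoeff_laplaceTransform ht, Measure.restrict_smul, integral_smul_nnreal_measure,
    restrict_dirac' measurableSet_Ici, if_pos (mem_Ici.2 hx₀), integral_dirac, NNReal.smul_def,
    smul_eq_mul]
  ring

theorem isLogConcaveSeq_altTaylorCoeff_laplaceTransform_withDensity {f : ℝ → ℝ}
    (hf : IsLogConcaveOn (Ici 0) f) {μ : Measure ℝ} [IsFiniteMeasure μ]
    (hμ : μ = (volume.restrict (Ici 0)).withDensity fun x => ENNReal.ofReal (f x)) {t : ℝ}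
    (ht : 0 < t) : IsLogConcaveSeq (altTaylorCoeff (laplaceTransform μ) t) := by
  have toReal_smul (n : ℕ) : ∀ x ∈ Ioi (0 : ℝ), (ENNReal.ofReal (f x)).toReal •
      (x ^ n * Real.exp (-(t * x))) = x ^ n * (f x * Real.exp (-(t * x))) := fun x hx => by
    rw [ENNReal.toReal_ofReal (hf.2.1 x (Ioi_subset_Ici_self hx)), smul_eq_mul, mul_left_comm]
  have restrict_Ici : μ.restrict (Ici 0) = μ := by
    rw [hμ, restrict_withDensity measurableSet_Ici, Measure.restrict_restrict measurableSet_Ici,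
      inter_self]
  have hdensity := hf.aemeasurable.ennreal_ofReal
  have lt_top : ∀ᵐ x ∂volume.restrict (Ici 0), ENNReal.ofReal (f x) < ⊤ :=
    ae_of_all _ fun _ => ENNReal.ofReal_lt_top
  have h_int (n : ℕ) :
      IntegrableOn (fun x => x ^ n * (f x * Real.exp (-(t * x)))) (Ioi 0) := by
    have h := integrableOn_pow_mul_exp_neg_mul_Ici (μ := μ) ht n
    rw [IntegrableOn, restrict_Ici, hμ,
      integrable_withDensity_iff_integrable_smul₀' hdensity lt_top] at h
    exact (IntegrableOn.mono_set h Ioi_subset_Ici_self).congr_fun (toReal_smul n) measurableSet_Ioi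
  have altTaylorCoeff_eq : altTaylorCoeff (laplaceTransform μ) t =
      normalizedMoment fun x => f x * Real.exp (-(t * x)) := by
    ext n
    rw [altTaylorCoeff_laplaceTransform ht, normalizedMoment, restrict_Ici, hμ,
      integral_withDensity_eq_integral_toReal_smul₀ hdensity lt_top, integral_Ici_eq_integral_Ioi,
      setIntegral_congr_fun measurableSet_Ioi (toReal_smul n)]
  rw [altTaylorCoeff_eq]
  have hf_Ioi := hf.mono (convex_Ioi 0) Ioi_subset_Ici_self
  exact (hf_Ioi.mul (isLogConcaveOn_exp_neg_mul (convex_Ioi 0) t)).isLogConcaveSeq_normalizedMoment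
    h_int

theorem IsLogConcaveMeasureOnHalfLine.isLogConcaveSeq_altTaylorCoeff {μ : Measure ℝ}
    [IsFiniteMeasure μ] (hμ : IsLogConcaveMeasureOnHalfLine μ) {t : ℝ} (ht : 0 < t) :
    IsLogConcaveSeq (altTaylorCoeff (laplaceTransform μ) t) := by
  rcases hμ with ⟨c, x₀, hx₀, rfl⟩ | ⟨f, hf, hμ⟩
  · exact isLogConcaveSeq_altTaylorCoeff_laplaceTransform_smul_dirac c hx₀ ht
  · exact isLogConcaveSeq_altTaylorCoeff_laplaceTransform_withDensity hf hμ ht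

theorem altTaylorCoeff_congr {φ ψ : ℝ → ℝ} {t : ℝ} (h : φ =ᶠ[𝓝 t] ψ) :
    altTaylorCoeff φ t = altTaylorCoeff ψ t := by
  ext n
  rw [altTaylorCoeff, altTaylorCoeff, h.iteratedDeriv_eq]

theorem theorem1p1 (φ : ℝ → ℝ) (hcont : ContinuousOn φ (Ici 0))
    (hsmooth : ContDiffOn ℝ ∞ φ (Ioi 0)) :
    (∀ t : ℝ, 0 < t → IsLogConcaveSeq (altTaylorCoeff φ t)) ↔
      ∃ μ : Measure ℝ, IsFiniteMeasure μ ∧ IsLogConcaveMeasureOnHalfLine μ ∧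
        ∀ t : ℝ, 0 ≤ t → φ t = ∫ x in Ici (0 : ℝ), Real.exp (-(t * x)) ∂μ := by
  refine ⟨exists_isLogConcaveMeasureOnHalfLine hcont hsmooth, ?_⟩
  rintro ⟨μ, hfin, hμ, hφ⟩ t ht
  have eventuallyEq : φ =ᶠ[𝓝 t] laplaceTransform μ := by
    filter_upwards [Ioi_mem_nhds ht] with u hu using hφ u (le_of_lt hu)
  rw [altTaylorCoeff_congr eventuallyEq]
  exact hμ.isLogConcaveSeq_altTaylorCoeff ht
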